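/- Let $\gamma=\gamma_{\mathbb R^k}$ be the standard Gaussian measure on $\mathbb R^k$, with density $\varphi(x)=(2\pi)^{-k/2}e^{-\|x\|^2/2}$. Let $D\subset\mathbb R^k$ be a $C^2$ domain: a closed set with nonempty interior whose boundary $\partial D$ is an embedded $C^2$ hypersurface with $D$ locally on one side of it; let $\nu$ be its outward unit normal field. Put $T(D,r)=\{y: d(y,D)\le r\}$ and assume that the critical radius $$r_c(D)=\sup\{r\ge 0:\ \text{every } y \text{ with } d(y,D)\le r \text{ has a unique nearest point in } D\}\in[0,\infty]$$ is positive. For $j\ge 1$ let $\mathcal M_j(D,\cdot)$ be the (signed) Lebesgue Minkowski curvature measure $$\mathcal M_j(D,dp)=(j-1)!\,e_{j-1}(\kappa_1(p),\dots,\kappa_{k-1}(p))\,\mathcal H_{k-1}(dp)\quad\text{on }\partial D,$$ where $e_{i}$ is the $i$-th elementary symmetric polynomial (so $\mathcal M_j=0$ for $j>k$) and the $\kappa_i(p)$ are the principal curvatures, i.e. the eigenvalues of $Z\mapsto\nabla_Z\nu$ on $T_p\partial D$. Define the Gaussian Minkowski functionals by $\mathcal M_0^{\gamma}(D)=\gamma(D)$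 and, for $l\ge 1$, $$\mathcal M_l^{\gamma}(D)=\sum_{m=0}^{l-1}\int_{\partial D}\binom{l-1}{m}\frac{d^{\,l-1-m}\varphi}{d\nu^{\,l-1-m}}\Big|_x\,\mathcal M_{m+1}(D,dx),$$ where $\frac{d^{i}\varphi}{d\nu^{i}}\big|_x=\frac{d^i}{dt^i}\varphi(x+t\nu_x)\big|_{t=0}$. Let $H_m$ be the Hermite polynomials, $\frac{d^m}{dx^m}e^{-x^2/2}=(-1)^mH_m(x)e^{-x^2/2}$. Then: 1. For every $l\ge 1$, $$\mathcal M_l^{\gamma}(D)=\frac1{(2\pi)^{k/2}}\sum_{m=0}^{l-1}(-1)^m\binom{l-1}{m}\int_{\partial D}H_m(\langle p,\nu_p\rangle)\,e^{-\|p\|^2/2}\,\mathcal M_{l-m}(D,dp).$$ 2. Suppose further that for every $1\le j\le k$ there is $\beta>0$ with $\int_{\partial D}\frac{1}{1+\|p\|^{\beta}}\,|\mathcal M_j|(D,dp)<\infty$. Then all the integrals in 1 converge absolutely, and $\gamma(T(D,r))$ has the formal expansion $$\gamma(T(D,r))\sim\gamma(D)+\sum_{j\ge1}\frac{r^j}{j!}\,\mathcal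 M_j^{\gamma}(D),$$ in the following sense: for every integer $N\ge 0$ there is a constant $K=K(N,D)$ such that for all $0\le r<\min(r_c(D),1)$ $$\Big|\gamma(T(D,r))-\gamma(D)-\sum_{j=1}^{N}\frac{r^j}{j!}\,\mathcal M_j^{\gamma}(D)\Big|\le K\,r^{N+1}.$$ -/

import Mathlib

open MeasureTheory
open scoped ENNReal NNReal

noncomputable section

namespace GaussTube

/-- The Euclidean space `ℝᵏ`. -/
abbrev E (k : ℕ) : Type := EuclideanSpace ℝ (Fin k)

/-- `f` is a `C²` defining function of `D` on the open neighbourhood `U` of `p`: it has no critical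
point in `U`, and `D ∩ U = {f ≤ 0} ∩ U`. -/
structure IsDefiningFunctionAt {k : ℕ} (D : Set (E k)) (p : E k) (U : Set (E k)) (f : E k → ℝ) :
    Prop where
  isOpen : IsOpen U
  mem : p ∈ U
  contDiffOn : ContDiffOn ℝ 2 f U
  gradient_ne_zero : ∀ x ∈ U, gradient f x ≠ 0
  inter_eq : D ∩ U = {x | f x ≤ 0} ∩ U

/-- A `C²` domain in `ℝᵏ`: a closed set with nonempty interior whose boundary is an embedded `C²`
hypersurface, with `D` lying locally on one side of it (so that there is an outward normal). -/
structure IsC2Domain {k : ℕ} (D : Set (E k)) : Prop where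
  isClosed : IsClosed D
  nonempty_interior : (interior D).Nonempty
  exists_definingFunction : ∀ p ∈ frontier D, ∃ U f, IsDefiningFunctionAt D p U f

/-- `v` is the outward unit normal of `D` at `p`: the normalized gradient at `p` of a defining
function. -/
def IsOutwardUnitNormalAt {k : ℕ} (D : Set (E k)) (p v : E k) : Prop :=
  ∃ U f, IsDefiningFunctionAt D p U f ∧ v = ‖gradient f p‖⁻¹ • gradient f p

/-- The outward unit normal field `ν` of a `C²` domain. Only its values on `∂D` matter; there the
vector described by `IsOutwardUnitNormalAt` exists and is unique. -/
def outwardNormal {k : ℕ} (D : Set (E k)) (p : E k) : E k :=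
  Classical.epsilon fun v => IsOutwardUnitNormalAt D p v

/-- The tangent space `T_p ∂D = ν_p^⊥`. -/
abbrev tangentSpace {k : ℕ} (D : Set (E k)) (p : E k) : Submodule ℝ (E k) :=
  (Submodule.span ℝ {outwardNormal D p})ᗮ

/-- The shape operator `S_p Z = -∇_Z ν` of `∂D` at `p`, acting on `T_p ∂D`. The field `ν` is
differentiated along `∂D`; the derivative in tangent directions does not depend on the choice of a
derivative within `∂D`. -/
def shapeOperator {k : ℕ} (D : Set (E k)) (p : E k) : tangentSpace D p →ₗ[ℝ] tangentSpace D p :=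
  -((tangentSpace D p).orthogonalProjectionOnto.toLinearMap ∘ₗ
    (fderivWithin ℝ (outwardNormal D) (frontier D) p).toLinearMap ∘ₗ (tangentSpace D p).subtype)

/-- The principal curvatures `κ_i = -λ_i`, where `λ_i` are the eigenvalues of the shape operator,
with multiplicity; with this sign they are positive on the boundary of a ball. -/
def principalCurvatures {k : ℕ} (D : Set (E k)) (p : E k) : Multiset ℝ :=
  (shapeOperator D p).charpoly.roots.map fun x => -x

/-- The density `(j-1)! e_{j-1}(κ_1, …, κ_{k-1})` (for `j ≥ 1`) of the Lebesgue Minkowski curvature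
measure `M_j(D, ·)` with respect to the surface measure `H_{k-1}` on `∂D`. It is zero for
`j > k`. -/
def curvatureDensity {k : ℕ} (D : Set (E k)) (j : ℕ) (p : E k) : ℝ :=
  ((j - 1).factorial : ℝ) * (principalCurvatures D p).esymm (j - 1)

/-- `∫_{∂D} g(p) M_j(D, dp)` for the signed measure `M_j(D, ·)`, `j ≥ 1`. Here `μHE[k - 1]` is the
`(k-1)`-dimensional Hausdorff measure in its Euclidean normalization. -/
def curvatureIntegral {k : ℕ} (D : Set (E k)) (j : ℕ) (g : E k → ℝ) : ℝ :=
  ∫ p in frontier D, g p * curvatureDensity D j p ∂(μHE[k - 1])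

/-- `g` is (absolutely) integrable over `∂D` with respect to the signed measure `M_j(D, ·)`. -/
def CurvatureIntegrable {k : ℕ} (D : Set (E k)) (j : ℕ) (g : E k → ℝ) : Prop :=
  IntegrableOn (fun p => g p * curvatureDensity D j p) (frontier D) μHE[k - 1]

/-- The coefficient
`C_l(D; φ) = ∑_{m=0}^{l-1} ∫_{∂D} binom(l-1, m) (d^{l-1-m} φ / dν^{l-1-m})(x) M_{m+1}(D, dx)`. -/
def tubeCoeff {k : ℕ} (D : Set (E k)) (φ : E k → ℝ) (l : ℕ) : ℝ :=
  ∑ m ∈ Finset.range l, curvatureIntegral D (m + 1) fun x =>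
    ((l - 1).choose m : ℝ) *
      iteratedDeriv (l - 1 - m) (fun t : ℝ => φ (x + t • outwardNormal D x)) 0

/-- The density `(2π)^{-k/2} e^{-‖x‖²/2}`. -/
def gaussianDensity (k : ℕ) (x : E k) : ℝ :=
  (2 * Real.pi) ^ (-(k : ℝ) / 2) * Real.exp (-‖x‖ ^ 2 / 2)

/-- The canonical Gaussian measure `γ` on `ℝᵏ`. -/
def gaussianMeasure (k : ℕ) : Measure (E k) :=
  volume.withDensity fun x => ENNReal.ofReal (gaussianDensity k x)

/-- The Gaussian Minkowski functionals: `M_0^γ(D) = γ(D)`, and `M_l^γ(D) = C_l(D; φ)` for `l ≥ 1`,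
with `φ` the Gaussian density. -/
def gaussianMinkowski {k : ℕ} (D : Set (E k)) : ℕ → ℝ
  | 0 => (gaussianMeasure k).real D
  | l + 1 => tubeCoeff D (gaussianDensity k) (l + 1)

/-- The integrand `H_m(⟨p, ν_p⟩) e^{-‖p‖²/2}`, with `H_m` the probabilists' Hermite polynomial,
`(d/dx)^m e^{-x²/2} = (-1)^m H_m(x) e^{-x²/2}`. -/
def hermiteWeight {k : ℕ} (D : Set (E k)) (m : ℕ) (p : E k) : ℝ :=
  Polynomial.aeval (inner ℝ p (outwardNormal D p)) (Polynomial.hermite m) * Real.exp (-‖p‖ ^ 2 / 2)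

/-- The tube `T(D, r) = {y | d(y, D) ≤ r}`. -/
def tube {k : ℕ} (D : Set (E k)) (r : ℝ) : Set (E k) :=
  {y | Metric.infDist y D ≤ r}

/-- The critical radius `r_c(D)`: the supremum, in `[0, ∞]`, of the `r ≥ 0` such that every `y` with
`d(y, D) ≤ r` has a unique nearest point in `D`. -/
def criticalRadius {k : ℕ} (D : Set (E k)) : ℝ≥0∞ :=
  ⨆ r ∈ {r : ℝ≥0 | ∀ y : E k, Metric.infDist y D ≤ r →
    ∃! x, x ∈ D ∧ dist x y = Metric.infDist y D}, (r : ℝ≥0∞)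

end GaussTube

end

/-! The expansion is Weyl's tube formula, integrated against the Gaussian density and Taylor
expanded along normals. Below the critical radius the map (p, t) ↦ p + t ν_p is a bijection from ∂D
× (0, r] onto T(D, r) \ D. The main point is that normal segments stay distance-minimizing up to any
R for which nearest points are unique (`UniqueNearest.infDist_add`,
`infDist_add_smul_outwardNormal`).

The area formula `volume_normalMap_image` gives this map the Jacobian det(1 + t∇ν). It is proved by
local comparison. A flattening of ∂D with derivative the identity turns surface measure times length
into volume, up to a factor near 1. The remaining map of the ambient space is strictly
differentiable with the right determinant. Countable additivity globalizes the estimate, and the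
factor is sent to 1. Since ∇ν is symmetric on the tangent space, the Jacobian is ∏(1 + tκ_i) = Σ t^j
e_j(κ), which is positive for 0 ≤ t < R.

Hence γ(T(D, r) \ D) is a finite sum of curvature integrals of the moments ∫₀ʳ t^j φ(p + tν_p) dt,
each divided by j!. Along a unit-speed line φ is a constant multiple of a one-dimensional Gaussian.
Its derivatives are therefore Hermite polynomials times φ, which gives the first claim, and they are
bounded by a multiple of 1/(1 + ‖p‖^β) uniformly for t in [0, 1] (`exists_hermite_mul_exp_le`). So
the pointwise Taylor remainder is integrable over ∂D, and collecting powers of r produces the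
functionals M_l^γ. -/

namespace GaussTube

open Filter Topology Set

/-! ### Polarity for a half-space. -/

section Halfspace

variable {F : Type*} [NormedAddCommGroup F] [InnerProductSpace ℝ F]

/-- A vector `w` that makes an obtuse angle with every vector of the open half-space opposite to the
unit vector `v` is a nonnegative multiple of `v`. -/
theorem eq_norm_smul_of_forall_inner_nonpos {v w : F} (hv : ‖v‖ = 1)
    (h : ∀ z, inner ℝ z v < 0 → inner ℝ z w ≤ 0) : w = ‖w‖ • v := by
  have hvv : inner ℝ v v = (1 : ℝ) := by rw [real_inner_self_eq_norm_sq, hv]; norm_num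
  set c : ℝ := inner ℝ w v with hc
  have hc0 : 0 ≤ c := by
    have := h (-v) (by rw [inner_neg_left, hvv]; norm_num)
    rw [inner_neg_left, real_inner_comm] at this
    linarith
  have key : w = c • v := by
    have h1 : inner ℝ (w - c • v) v = (0 : ℝ) := by
      rw [inner_sub_left, real_inner_smul_left, hvv]; simp [hc]
    have h2 : inner ℝ (w - c • v) (w - c • v) = inner ℝ (w - c • v) w := by
      rw [inner_sub_right (w - c • v) w, real_inner_smul_right, h1]; ring
    -- The test vector is the part of w orthogonal to v, pushed by −εv into the open half-space; ε →
    -- 0 then forces that part to vanish.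
    have h3 : ∀ ε : ℝ, 0 < ε → inner ℝ (w - c • v) w ≤ ε * c := by
      intro ε hε
      have := h (w - c • v - ε • v) (by rw [inner_sub_left, h1, real_inner_smul_left, hvv]; linarith)
      rw [inner_sub_left, real_inner_smul_left, real_inner_comm w v, ← hc] at this
      linarith
    have h4 : inner ℝ (w - c • v) w ≤ 0 := by
      have ht : Tendsto (fun ε : ℝ => ε * c) (𝓝[>] 0) (𝓝 (0 * c)) :=
        ((continuous_id.mul continuous_const).tendsto 0).mono_left nhdsWithin_le_nhds
      rw [zero_mul] at ht
      exact ge_of_tendsto ht (eventually_nhdsWithin_of_forall fun ε hε => h3 ε hε)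
    rw [← h2] at h4
    rw [real_inner_self_eq_norm_sq] at h4
    exact sub_eq_zero.mp (norm_eq_zero.mp (pow_eq_zero_iff two_ne_zero |>.mp
      (le_antisymm h4 (sq_nonneg _))))
  have : ‖w‖ = c := by rw [key, norm_smul, hv, Real.norm_of_nonneg hc0, mul_one]
  rw [this]; exact key

end Halfspace

/-! ### Defining functions and the outward unit normal. -/

section Normal

variable {k : ℕ} {D U : Set (E k)} {f : E k → ℝ} {p q : E k}

/-- The normalized gradient `∇f / ‖∇f‖`. -/
noncomputable def unitGradient (f : E k → ℝ) (x : E k) : E k :=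
  ‖gradient f x‖⁻¹ • gradient f x

namespace IsDefiningFunctionAt

theorem of_mem (h : IsDefiningFunctionAt D p U f) (hq : q ∈ U) : IsDefiningFunctionAt D q U f :=
  ⟨h.isOpen, hq, h.contDiffOn, h.gradient_ne_zero, h.inter_eq⟩

theorem differentiableAt (h : IsDefiningFunctionAt D p U f) (hq : q ∈ U) :
    DifferentiableAt ℝ f q :=
  (h.contDiffOn.differentiableOn (by norm_num)).differentiableAt (h.isOpen.mem_nhds hq)

theorem contDiffOn_gradient (h : IsDefiningFunctionAt D p U f) :
    ContDiffOn ℝ 1 (gradient f) U :=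
  (InnerProductSpace.toDual ℝ (E k)).symm.contDiff.comp_contDiffOn
    (h.contDiffOn.fderiv_of_isOpen h.isOpen (by norm_num))

theorem contDiffOn_unitGradient (h : IsDefiningFunctionAt D p U f) :
    ContDiffOn ℝ 1 (unitGradient f) U :=
  (((h.contDiffOn_gradient).norm ℝ h.gradient_ne_zero).inv
    fun x hx => norm_ne_zero_iff.mpr (h.gradient_ne_zero x hx)).smul h.contDiffOn_gradient

theorem norm_unitGradient (h : IsDefiningFunctionAt D p U f) (hq : q ∈ U) :
    ‖unitGradient f q‖ = 1 := by
  rw [unitGradient, norm_smul, norm_inv, norm_norm,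
    inv_mul_cancel₀ (norm_ne_zero_iff.mpr (h.gradient_ne_zero q hq))]

theorem mem_iff (h : IsDefiningFunctionAt D p U f) (hq : q ∈ U) : q ∈ D ↔ f q ≤ 0 := by
  have := congrArg (q ∈ ·) h.inter_eq
  simpa [hq] using this

theorem hasDerivAt_line (h : IsDefiningFunctionAt D p U f) (hq : q ∈ U) (w : E k) :
    HasDerivAt (fun s : ℝ => f (q + s • w)) (inner ℝ w (gradient f q)) 0 := by
  have h1 : HasFDerivAt f (fderiv ℝ f q) (q + (0 : ℝ) • w) := by
    simpa using (h.differentiableAt hq).hasFDerivAt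
  have h2 : HasDerivAt (fun s : ℝ => q + s • w) w 0 := by
    simpa using ((hasDerivAt_id (0 : ℝ)).smul_const w).const_add q
  have := h1.comp_hasDerivAt (0 : ℝ) h2
  rwa [← inner_gradient_left, real_inner_comm] at this

theorem eventually_mem_line (h : IsDefiningFunctionAt D p U f) (hq : q ∈ U) (w : E k) :
    ∀ᶠ s : ℝ in 𝓝 0, q + s • w ∈ U := by
  have hc : Continuous fun s : ℝ => q + s • w := by fun_prop
  exact hc.continuousAt.eventually_mem (h.isOpen.mem_nhds (by simpa using hq))

theorem eventually_mem (h : IsDefiningFunctionAt D p U f) (hq : q ∈ U) (hf : f q ≤ 0) {w : E k}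
    (hw : inner ℝ w (gradient f q) < 0) : ∀ᶠ s : ℝ in 𝓝[>] 0, q + s • w ∈ D := by
  have h1 := (h.hasDerivAt_line hq w).tendsto_slope_zero_right
  have h2 := h1.eventually_lt_const hw
  filter_upwards [h2, (h.eventually_mem_line hq w).filter_mono nhdsWithin_le_nhds,
    self_mem_nhdsWithin] with s hs hU hpos
  rw [h.mem_iff hU]
  simp only [zero_add, zero_smul, add_zero, smul_eq_mul] at hs
  have : f (q + s • w) - f q < 0 := by
    by_contra hcon
    exact absurd hs (not_lt.mpr (mul_nonneg (inv_nonneg.mpr (le_of_lt hpos)) (not_lt.mp hcon)))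
  linarith

theorem eventually_notMem (h : IsDefiningFunctionAt D p U f) (hq : q ∈ U) (hf : f q = 0) {w : E k}
    (hw : 0 < inner ℝ w (gradient f q)) : ∀ᶠ s : ℝ in 𝓝[>] 0, q + s • w ∉ D := by
  have h1 := (h.hasDerivAt_line hq w).tendsto_slope_zero_right
  have h2 := h1.eventually_const_lt hw
  filter_upwards [h2, (h.eventually_mem_line hq w).filter_mono nhdsWithin_le_nhds,
    self_mem_nhdsWithin] with s hs hU hpos
  rw [h.mem_iff hU, not_le]
  simp only [zero_add, zero_smul, add_zero, smul_eq_mul, hf, sub_zero] at hs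
  exact pos_of_mul_pos_right hs (inv_nonneg.mpr (le_of_lt hpos))

theorem mem_frontier_iff (h : IsDefiningFunctionAt D p U f) (hD : IsClosed D) (hq : q ∈ U) :
    q ∈ frontier D ↔ f q = 0 := by
  constructor
  · intro hfr
    have hqD : q ∈ D := hD.frontier_subset hfr
    refine le_antisymm ((h.mem_iff hq).mp hqD) (not_lt.mp fun hlt => ?_)
    have h1 : ∀ᶠ x in 𝓝 q, f x < 0 :=
      (h.differentiableAt hq).continuousAt.eventually_lt_const hlt
    have h2 : ∀ᶠ x in 𝓝 q, x ∈ D := by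
      filter_upwards [h1, h.isOpen.mem_nhds hq] with x hx hxU
      exact (h.mem_iff hxU).mpr hx.le
    exact hfr.2 (mem_interior_iff_mem_nhds.mpr h2)
  · intro hf
    refine ⟨subset_closure ((h.mem_iff hq).mpr hf.le), fun hint => ?_⟩
    have hg : 0 < inner ℝ (gradient f q) (gradient f q) :=
      real_inner_self_pos.mpr (h.gradient_ne_zero q hq)
    have hc : Continuous fun s : ℝ => q + s • gradient f q := by fun_prop
    have h1 : ∀ᶠ s : ℝ in 𝓝 0, q + s • gradient f q ∈ D :=
      hc.continuousAt.eventually_mem (by simpa using mem_interior_iff_mem_nhds.mp hint)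
    obtain ⟨s, hs, hs'⟩ :=
      ((h.eventually_notMem hq hf hg).and (h1.filter_mono nhdsWithin_le_nhds)).exists
    exact hs hs'

theorem inner_unitGradient (w : E k) :
    inner ℝ w (unitGradient f q) = ‖gradient f q‖⁻¹ * inner ℝ w (gradient f q) := by
  rw [unitGradient, real_inner_smul_right]

/-- A direction that decreases f and increases f' would enter and leave D at once. So the two inward
half-spaces are nested, and the polarity lemma identifies their unit normals. -/
theorem unitGradient_eq (hD : IsClosed D) (hp : p ∈ frontier D) {U' : Set (E k)} {f' : E k → ℝ}
    (h : IsDefiningFunctionAt D p U f) (h' : IsDefiningFunctionAt D p U' f') :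
    unitGradient f p = unitGradient f' p := by
  have hf := (h.mem_frontier_iff hD h.mem).mp hp
  have hf' := (h'.mem_frontier_iff hD h'.mem).mp hp
  have hg : 0 < ‖gradient f p‖⁻¹ := inv_pos.mpr (norm_pos_iff.mpr (h.gradient_ne_zero p h.mem))
  have hg' : 0 < ‖gradient f' p‖⁻¹ := inv_pos.mpr (norm_pos_iff.mpr (h'.gradient_ne_zero p h'.mem))
  have := eq_norm_smul_of_forall_inner_nonpos (h.norm_unitGradient h.mem)
    (w := unitGradient f' p) fun z hz => by
      rw [inner_unitGradient] at hz ⊢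
      by_contra hcon
      have h1 : inner ℝ z (gradient f p) < 0 := by
        by_contra hc
        exact absurd hz (not_lt.mpr (mul_nonneg hg.le (not_lt.mp hc)))
      have h2 : 0 < inner ℝ z (gradient f' p) :=
        pos_of_mul_pos_right (not_le.mp hcon) hg'.le
      obtain ⟨s, hs, hs'⟩ := ((h.eventually_mem h.mem hf.le h1).and
        (h'.eventually_notMem h'.mem hf' h2)).exists
      exact hs' hs
  rw [h'.norm_unitGradient h'.mem, one_smul] at this
  exact this.symm

theorem outwardNormal_eq (h : IsDefiningFunctionAt D p U f) (hD : IsClosed D) (hq : q ∈ U)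
    (hqD : q ∈ frontier D) : outwardNormal D q = unitGradient f q := by
  have hex : ∃ v, IsOutwardUnitNormalAt D q v := ⟨_, U, f, h.of_mem hq, rfl⟩
  obtain ⟨U', f', h', he⟩ := Classical.epsilon_spec hex
  rw [outwardNormal, he]
  exact unitGradient_eq hD hqD h' (h.of_mem hq)

end IsDefiningFunctionAt

namespace IsC2Domain

theorem norm_outwardNormal (hD : IsC2Domain D) (hp : p ∈ frontier D) : ‖outwardNormal D p‖ = 1 := by
  obtain ⟨U, f, h⟩ := hD.exists_definingFunction p hp
  rw [h.outwardNormal_eq hD.isClosed h.mem hp, h.norm_unitGradient h.mem]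

theorem continuousOn_outwardNormal (hD : IsC2Domain D) :
    ContinuousOn (outwardNormal D) (frontier D) := by
  intro p hp
  obtain ⟨U, f, h⟩ := hD.exists_definingFunction p hp
  have h1 : ContinuousAt (unitGradient f) p :=
    h.contDiffOn_unitGradient.continuousOn.continuousAt (h.isOpen.mem_nhds h.mem)
  refine h1.continuousWithinAt.congr_of_eventuallyEq ?_ (h.outwardNormal_eq hD.isClosed h.mem hp)
  filter_upwards [self_mem_nhdsWithin, mem_nhdsWithin_of_mem_nhds (h.isOpen.mem_nhds h.mem)]
    with q hq hqU using h.outwardNormal_eq hD.isClosed hqU hq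

/-- Moving from a boundary point into the open half-space opposite to the normal enters `D`. -/
theorem eventually_mem (hD : IsC2Domain D) (hp : p ∈ frontier D) {w : E k}
    (hw : inner ℝ w (outwardNormal D p) < 0) : ∀ᶠ s : ℝ in 𝓝[>] 0, p + s • w ∈ D := by
  obtain ⟨U, f, h⟩ := hD.exists_definingFunction p hp
  have hf := (h.mem_frontier_iff hD.isClosed h.mem).mp hp
  refine h.eventually_mem h.mem hf.le ?_
  rw [h.outwardNormal_eq hD.isClosed h.mem hp, IsDefiningFunctionAt.inner_unitGradient] at hw
  by_contra hc
  exact absurd hw (not_lt.mpr (mul_nonneg (inv_nonneg.mpr (norm_nonneg _)) (not_lt.mp hc)))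

end IsC2Domain

end Normal

/-! ### Sets with unique nearest points: prolonging minimizing segments. -/

section UniqueNearest

/-- Every point at distance at most `R` from `D` has a unique nearest point in `D`. -/
def UniqueNearest {F : Type*} [NormedAddCommGroup F] (D : Set F) (R : ℝ) : Prop :=
  ∀ y : F, Metric.infDist y D ≤ R → ∃! x, x ∈ D ∧ dist x y = Metric.infDist y D

theorem UniqueNearest.eq {F : Type*} [NormedAddCommGroup F] {D : Set F} {R : ℝ}
    (hU : UniqueNearest D R) {x x' y : F} (hy : Metric.infDist y D ≤ R)
    (hx : x ∈ D) (hxy : dist x y = Metric.infDist y D) (hx' : x' ∈ D)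
    (hxy' : dist x' y = Metric.infDist y D) : x = x' :=
  (hU y hy).unique ⟨hx, hxy⟩ ⟨hx', hxy'⟩

variable {F : Type*} [NormedAddCommGroup F] {D : Set F} {R : ℝ}

/-- Nearest points depend continuously on the point. -/
theorem UniqueNearest.tendsto [ProperSpace F] (hU : UniqueNearest D R) (hD : IsClosed D)
    {ι : Type*} {l : Filter ι} {u x : ι → F} {y q : F} (hy : Metric.infDist y D ≤ R) (hq : q ∈ D)
    (hqy : dist q y = Metric.infDist y D) (hu : Tendsto u l (𝓝 y))
    (hx : ∀ᶠ i in l, x i ∈ D ∧ dist (x i) (u i) = Metric.infDist (u i) D) :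
    Tendsto x l (𝓝 q) := by
  -- Along an ultrafilter the nearest points lie in a compact ball and so converge. Their limit is a
  -- nearest point of y, hence equals q.
  rw [tendsto_iff_ultrafilter]
  intro g hg
  have hu' : Tendsto u g (𝓝 y) := hu.mono_left hg
  have hx' := hx.filter_mono hg
  have hinf : Tendsto (fun i => Metric.infDist (u i) D) g (𝓝 (Metric.infDist y D)) :=
    (Metric.continuous_infDist_pt D).continuousAt.tendsto.comp hu'
  have hK : IsCompact (Metric.closedBall y (Metric.infDist y D + 2)) := isCompact_closedBall _ _
  have hmem : ∀ᶠ i in (g : Filter ι), x i ∈ Metric.closedBall y (Metric.infDist y D + 2) := by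
    filter_upwards [hx', hinf.eventually_lt_const (lt_add_one _),
      hu'.eventually (Metric.ball_mem_nhds y one_pos)] with i h1 h2 h3
    rw [Metric.mem_closedBall]
    have := dist_triangle (x i) (u i) y
    linarith [h1.2]
  have hle : ((g.map x : Ultrafilter F) : Filter F) ≤
      𝓟 (Metric.closedBall y (Metric.infDist y D + 2)) := by
    rw [le_principal_iff]; exact hmem
  obtain ⟨z, -, hz⟩ := hK.ultrafilter_le_nhds _ hle
  have hz' : Tendsto x g (𝓝 z) := hz
  have hzD : z ∈ D := hD.mem_of_tendsto hz' (hx'.mono fun i hi => hi.1)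
  have hzy : dist z y = Metric.infDist y D := by
    refine tendsto_nhds_unique ((hz'.dist hu').congr' ?_) hinf
    exact hx'.mono fun i hi => hi.2
  rw [hU.eq hy hq hqy hzD hzy]
  exact hz'

variable [InnerProductSpace ℝ F]

/-- First variation of the distance: the nearest point to y + εw tends to q, so the cross term 2ε⟨w,
y − x_ε⟩ is eventually positive, while ‖y − x_ε‖ is never below the distance of y. -/
theorem UniqueNearest.eventually_infDist_lt [ProperSpace F] (hU : UniqueNearest D R)
    (hD : IsClosed D) {y q w : F} (hy : Metric.infDist y D ≤ R) (hq : q ∈ D)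
    (hqy : dist q y = Metric.infDist y D) (hw : 0 < inner ℝ w (y - q)) :
    ∀ᶠ ε : ℝ in 𝓝[>] 0, Metric.infDist y D < Metric.infDist (y + ε • w) D := by
  have hne : D.Nonempty := ⟨q, hq⟩
  choose x hxD hx using fun ε : ℝ => hD.exists_infDist_eq_dist hne (y + ε • w)
  have hu : Tendsto (fun ε : ℝ => y + ε • w) (𝓝[>] 0) (𝓝 y) := by
    have : Continuous fun ε : ℝ => y + ε • w := by fun_prop
    have := this.tendsto 0
    rw [zero_smul, add_zero] at this
    exact this.mono_left nhdsWithin_le_nhds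
  have ht : Tendsto x (𝓝[>] 0) (𝓝 q) := hU.tendsto hD hy hq hqy hu
    (Eventually.of_forall fun ε => ⟨hxD ε, by rw [dist_comm, ← hx ε]⟩)
  have hin : Tendsto (fun ε => inner ℝ w (y - x ε)) (𝓝[>] 0) (𝓝 (inner ℝ w (y - q))) :=
    tendsto_const_nhds.inner (tendsto_const_nhds.sub ht)
  filter_upwards [hin.eventually_const_lt hw, self_mem_nhdsWithin] with ε hε hpos
  have hpos' : (0 : ℝ) < ε := hpos
  rw [hx ε, dist_eq_norm]
  have h1 : Metric.infDist y D ≤ ‖y - x ε‖ := by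
    rw [← dist_eq_norm]; exact Metric.infDist_le_dist_of_mem (hxD ε)
  have h2 : ‖y + ε • w - x ε‖ ^ 2 = ‖y - x ε‖ ^ 2 + 2 * (ε * inner ℝ w (y - x ε)) + ‖ε • w‖ ^ 2 := by
    rw [show y + ε • w - x ε = (y - x ε) + ε • w by abel, norm_add_sq_real,
      real_inner_smul_right, real_inner_comm]
  refine lt_of_le_of_lt h1 (lt_of_pow_lt_pow_left₀ 2 (norm_nonneg _) ?_)
  rw [h2]
  have := mul_pos hpos' hε
  nlinarith [sq_nonneg ‖ε • w‖]

/-- A segment realizing the distance to `D` can be prolonged as long as nearest points are unique.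
The far end is found as a maximizer of the distance on a small ball. -/
theorem UniqueNearest.infDist_add [ProperSpace F] (hU : UniqueNearest D R) (hD : IsClosed D)
    {p v : F} {τ s : ℝ} (hp : p ∈ D) (hv : ‖v‖ = 1) (hτ : Metric.infDist (p + τ • v) D = τ)
    (hs : 0 < s) (hsτ : s < τ) (hR : τ + s ≤ R) :
    Metric.infDist (p + (τ + s) • v) D = τ + s := by
  have hne : D.Nonempty := ⟨p, hp⟩
  set y₀ := p + τ • v with hy₀
  obtain ⟨y₁, hy₁, hmax⟩ := (isCompact_closedBall y₀ s).exists_isMaxOn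
    ⟨y₀, Metric.mem_closedBall_self hs.le⟩ (Metric.continuous_infDist_pt D).continuousOn
  have hmax' : ∀ y ∈ Metric.closedBall y₀ s, Metric.infDist y D ≤ Metric.infDist y₁ D :=
    fun y hy => hmax hy
  set d := Metric.infDist y₁ D with hd
  have hτd : τ ≤ d := hτ ▸ hmax' y₀ (Metric.mem_closedBall_self hs.le)
  have hdτ : d ≤ τ + s := by
    have := Metric.infDist_le_infDist_add_dist (s := D) (x := y₁) (y := y₀)
    rw [hτ] at this
    linarith [Metric.mem_closedBall.mp hy₁]
  obtain ⟨q, hqD, hq⟩ := hD.exists_infDist_eq_dist hne y₁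
  have hqn : ‖y₁ - q‖ = d := by rw [← dist_eq_norm, ← hq]
  have hd0 : 0 < d := by linarith
  -- Directions that increase the distance must leave the ball, because y₁ maximizes the distance on
  -- it.
  have hout : ∀ w, 0 < inner ℝ w (y₁ - q) → ∀ᶠ ε : ℝ in 𝓝[>] 0, s < ‖y₁ - y₀ + ε • w‖ := by
    intro w hw
    filter_upwards [hU.eventually_infDist_lt hD (hdτ.trans hR) hqD (by rw [dist_comm, ← hq]) hw]
      with ε hε
    by_contra hcon
    refine absurd (hmax' (y₁ + ε • w) ?_) (not_le.mpr hε)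
    rw [Metric.mem_closedBall, dist_eq_norm, show y₁ + ε • w - y₀ = y₁ - y₀ + ε • w by abel]
    exact not_lt.mp hcon
  set u := d⁻¹ • (y₁ - q) with hu
  have hu1 : ‖u‖ = 1 := by
    rw [hu, norm_smul, hqn, norm_inv, Real.norm_of_nonneg hd0.le, inv_mul_cancel₀ hd0.ne']
  have hdu : y₁ - q = d • u := by rw [hu, smul_smul, mul_inv_cancel₀ hd0.ne', one_smul]
  have hy₁n : ‖y₁ - y₀‖ ≤ s := by rw [← dist_eq_norm]; exact Metric.mem_closedBall.mp hy₁
  -- All directions in the half-space of u lead out of the ball, so y₁ − y₀ is polar to the opposite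
  -- half-space and hence a nonnegative multiple of u.
  have hpar : y₁ - y₀ = ‖y₁ - y₀‖ • u := by
    refine eq_norm_smul_of_forall_inner_nonpos hu1 fun z hz => ?_
    by_contra hcon
    rw [not_le] at hcon
    have hw : 0 < inner ℝ (-z) (y₁ - q) := by
      rw [hdu, inner_neg_left, real_inner_smul_right]
      nlinarith
    have hlim : Tendsto (fun ε : ℝ => -2 * inner ℝ z (y₁ - y₀) + ε * ‖z‖ ^ 2) (𝓝[>] 0)
        (𝓝 (-2 * inner ℝ z (y₁ - y₀) + 0 * ‖z‖ ^ 2)) := by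
      refine Tendsto.mono_left (Continuous.tendsto ?_ 0) nhdsWithin_le_nhds
      fun_prop
    obtain ⟨ε, ⟨h1, h2⟩, h3⟩ := (((hout (-z) hw).and
      (hlim.eventually_lt_const (u := 0) (by linarith))).and self_mem_nhdsWithin).exists
    have h3' : (0 : ℝ) < ε := h3
    have h4 : ‖y₁ - y₀ + ε • -z‖ ^ 2 = ‖y₁ - y₀‖ ^ 2 +
        ε * (-2 * inner ℝ z (y₁ - y₀) + ε * ‖z‖ ^ 2) := by
      rw [norm_add_sq_real, real_inner_smul_right, inner_neg_right, real_inner_comm, norm_smul,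
        norm_neg, mul_pow, Real.norm_eq_abs, sq_abs]
      ring
    have h5 : s ^ 2 < ‖y₁ - y₀ + ε • -z‖ ^ 2 := pow_lt_pow_left₀ h1 hs.le two_ne_zero
    have h6 : ‖y₁ - y₀‖ ^ 2 ≤ s ^ 2 := pow_le_pow_left₀ (norm_nonneg _) hy₁n 2
    nlinarith
  -- An interior maximizer is impossible, since a small move along u would stay in the ball.
  have hsn : ‖y₁ - y₀‖ = s := by
    refine le_antisymm hy₁n (le_of_forall_pos_lt_add fun δ hδ => ?_)
    have hw : 0 < inner ℝ u (y₁ - q) := by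
      rw [hdu, real_inner_smul_right, real_inner_self_eq_norm_sq, hu1]; linarith
    obtain ⟨ε, h1, h2⟩ := ((hout u hw).and (Ioo_mem_nhdsGT hδ)).exists
    have := norm_add_le (y₁ - y₀) (ε • u)
    rw [norm_smul, hu1, mul_one, Real.norm_of_nonneg h2.1.le] at this
    linarith [h2.2]
  rw [hsn] at hpar
  -- Thus y₀ lies on the segment from q to y₁; s < τ ≤ d keeps d − s positive. From τ ≤ d − s and d
  -- ≤ τ + s follows equality, so q is also nearest to y₀ and must be p.
  have hy₀q : y₀ - q = (d - s) • u := by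
    rw [sub_smul, ← hdu, ← hpar]; abel
  have hy₀n : dist q y₀ = d - s := by
    rw [dist_comm, dist_eq_norm, hy₀q, norm_smul, hu1, mul_one, Real.norm_of_nonneg (by linarith)]
  have hle : τ ≤ dist q y₀ := by
    rw [← hτ, dist_comm]; exact Metric.infDist_le_dist_of_mem hqD
  have hds : d = τ + s := by linarith
  have hpq : p = q := by
    refine hU.eq (y := y₀) (by rw [hτ]; linarith) hp ?_ hqD (by rw [hτ]; linarith)
    rw [hτ, hy₀, dist_eq_norm, sub_add_cancel_left, norm_neg, norm_smul, hv, mul_one,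
      Real.norm_of_nonneg (by linarith)]
  have huv : u = v := by
    have : τ • v = τ • u := by
      rw [show τ = d - s by linarith, ← hy₀q, ← hpq, hy₀, add_sub_cancel_left]
      congr 1; linarith
    exact (smul_right_injective F (show τ ≠ 0 by linarith) this).symm
  have : p + (τ + s) • v = y₁ := by
    rw [← hds, ← huv, ← hdu, hpq]; abel
  rw [this, ← hds]

theorem infDist_add_smul_of_le {p v : F} {τ t : ℝ} (hp : p ∈ D) (hv : ‖v‖ = 1)
    (hτ : Metric.infDist (p + τ • v) D = τ) (ht : 0 ≤ t) (htτ : t ≤ τ) :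
    Metric.infDist (p + t • v) D = t := by
  refine le_antisymm ?_ ?_
  · refine (Metric.infDist_le_dist_of_mem hp).trans ?_
    rw [dist_eq_norm, add_sub_cancel_left, norm_smul, hv, mul_one, Real.norm_of_nonneg ht]
  · have := Metric.infDist_le_infDist_add_dist (s := D) (x := p + τ • v) (y := p + t • v)
    rw [hτ, dist_eq_norm, add_sub_add_left_eq_sub, ← sub_smul, norm_smul, hv, mul_one,
      Real.norm_of_nonneg (by linarith)] at this
    linarith

/-- One prolongation must be strictly shorter than the segment already known, so the length is
multiplied repeatedly by 3/2, capped at R, until R is reached. Shorter times follow from the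
triangle inequality. -/
theorem UniqueNearest.infDist_add_smul [ProperSpace F] (hU : UniqueNearest D R) (hD : IsClosed D)
    {p v : F} {τ t : ℝ} (hp : p ∈ D) (hv : ‖v‖ = 1) (hτ0 : 0 < τ) (hτR : τ ≤ R)
    (hτ : Metric.infDist (p + τ • v) D = τ) (ht : 0 ≤ t) (htR : t ≤ R) :
    Metric.infDist (p + t • v) D = t := by
  have key : ∀ n : ℕ, Metric.infDist (p + (min R ((3 / 2) ^ n * τ)) • v) D =
      min R ((3 / 2) ^ n * τ) := by
    intro n
    induction n with
    | zero => simpa [min_eq_right hτR] using hτ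
    | succ n ih =>
      set a := (3 / 2 : ℝ) ^ n * τ with ha
      have ha0 : 0 < a := by positivity
      have hb : (3 / 2 : ℝ) ^ (n + 1) * τ = 3 / 2 * a := by rw [ha, pow_succ]; ring
      rw [hb]
      rcases le_or_gt R a with h | h
      · rw [min_eq_left h] at ih
        rwa [min_eq_left (by linarith)]
      · rw [min_eq_right h.le] at ih
        have hs : 0 < min R (3 / 2 * a) - a := by
          rw [sub_pos, lt_min_iff]; exact ⟨h, by linarith⟩
        have h2 : min R (3 / 2 * a) - a < a := by
          have := min_le_right R (3 / 2 * a); linarith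
        have := hU.infDist_add hD hp hv ih hs h2 (by rw [add_sub_cancel]; exact min_le_left _ _)
        rwa [add_sub_cancel] at this
  obtain ⟨n, hn⟩ := pow_unbounded_of_one_lt (R / τ) (by norm_num : (1 : ℝ) < 3 / 2)
  rw [div_lt_iff₀ hτ0] at hn
  have := key n
  rw [min_eq_left hn.le] at this
  exact infDist_add_smul_of_le hp hv this ht htR

/-- Moving from the nearest point q within D cannot bring it closer to y to first order. -/
theorem inner_sub_nonpos_of_eventually_mem {y q z : F}
    (hqy : dist q y = Metric.infDist y D) (hz : ∀ᶠ s : ℝ in 𝓝[>] 0, q + s • z ∈ D) :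
    inner ℝ z (y - q) ≤ 0 := by
  by_contra hcon
  rw [not_le] at hcon
  have hlim : Tendsto (fun ε : ℝ => -2 * inner ℝ z (y - q) + ε * ‖z‖ ^ 2) (𝓝[>] 0)
      (𝓝 (-2 * inner ℝ z (y - q) + 0 * ‖z‖ ^ 2)) := by
    refine Tendsto.mono_left (Continuous.tendsto ?_ 0) nhdsWithin_le_nhds
    fun_prop
  obtain ⟨ε, ⟨h1, h2⟩, h3⟩ := ((hz.and
    (hlim.eventually_lt_const (u := 0) (by linarith))).and self_mem_nhdsWithin).exists
  have h3' : (0 : ℝ) < ε := h3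
  have h4 : ‖y - (q + ε • z)‖ ^ 2 = ‖y - q‖ ^ 2 +
      ε * (-2 * inner ℝ z (y - q) + ε * ‖z‖ ^ 2) := by
    rw [show y - (q + ε • z) = (y - q) - ε • z by abel, norm_sub_sq_real, real_inner_smul_right,
      real_inner_comm, norm_smul, mul_pow, Real.norm_eq_abs, sq_abs]
    ring
  have h5 : ‖y - q‖ ≤ ‖y - (q + ε • z)‖ := by
    rw [← dist_eq_norm, ← dist_eq_norm, dist_comm y q, hqy]
    exact Metric.infDist_le_dist_of_mem h1
  have h6 := pow_le_pow_left₀ (norm_nonneg _) h5 2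
  nlinarith

end UniqueNearest

/-! ### The normal map parametrizes the outer tube. -/

section Domain

variable {k : ℕ} {D : Set (E k)} {R : ℝ} {p q : E k}

namespace IsC2Domain

theorem mem_frontier_of_nearest {y : E k} (hyD : y ∉ D) (hq : q ∈ D)
    (hqy : dist q y = Metric.infDist y D) : q ∈ frontier D := by
  refine ⟨subset_closure hq, fun hint => hyD ?_⟩
  have hc : Continuous fun s : ℝ => q + s • (y - q) := by fun_prop
  have h1 : ∀ᶠ s : ℝ in 𝓝 0, q + s • (y - q) ∈ D :=
    hc.continuousAt.eventually_mem (by simpa using mem_interior_iff_mem_nhds.mp hint)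
  have := inner_sub_nonpos_of_eventually_mem hqy (h1.filter_mono nhdsWithin_le_nhds)
  rw [real_inner_self_eq_norm_sq] at this
  have h0 : y - q = 0 := norm_eq_zero.mp (pow_eq_zero_iff two_ne_zero |>.mp
    (le_antisymm this (sq_nonneg _)))
  rwa [sub_eq_zero.mp h0]

/-- A point outside `D` lies on the normal ray from its nearest point. -/
theorem eq_add_smul_outwardNormal (hD : IsC2Domain D) {y : E k} (hyD : y ∉ D) (hq : q ∈ D)
    (hqy : dist q y = Metric.infDist y D) :
    y = q + Metric.infDist y D • outwardNormal D q := by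
  have hfr := mem_frontier_of_nearest hyD hq hqy
  have := eq_norm_smul_of_forall_inner_nonpos (hD.norm_outwardNormal hfr) (w := y - q)
    fun z hz => inner_sub_nonpos_of_eventually_mem hqy (hD.eventually_mem hfr hz)
  rw [← dist_eq_norm, dist_comm, hqy] at this
  rw [← this]; abel

theorem infDist_pos (hD : IsC2Domain D) {y : E k} (hy : y ∉ D) : 0 < Metric.infDist y D :=
  (hD.isClosed.notMem_iff_infDist_pos (hD.nonempty_interior.mono interior_subset)).mp hy

/-- A boundary point p is a limit of exterior points y, whose nearest points x(y) tend to p. The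
normal ray at x(y) is minimizing as far as y, hence up to R by prolongation, and continuity of ν
carries this to p. -/
theorem infDist_add_smul_outwardNormal (hD : IsC2Domain D) (hU : UniqueNearest D R) (hR : 0 < R)
    (hp : p ∈ frontier D) {t : ℝ} (ht : 0 ≤ t) (htR : t ≤ R) :
    Metric.infDist (p + t • outwardNormal D p) D = t := by
  have hpD : p ∈ D := hD.isClosed.frontier_subset hp
  have hne : D.Nonempty := ⟨p, hpD⟩
  have hp0 : Metric.infDist p D = 0 := Metric.infDist_zero_of_mem hpD
  choose x hxD hx using fun y => hD.isClosed.exists_infDist_eq_dist hne y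
  have hbot : (𝓝[Dᶜ] p).NeBot := by
    rw [← mem_closure_iff_nhdsWithin_neBot, closure_compl]; exact hp.2
  have hid : Tendsto (fun y : E k => y) (𝓝[Dᶜ] p) (𝓝 p) := tendsto_id.mono_left nhdsWithin_le_nhds
  have hxt : Tendsto x (𝓝[Dᶜ] p) (𝓝 p) := by
    refine hU.tendsto hD.isClosed (hp0.trans_le hR.le) hpD (by rw [dist_self, hp0]) hid ?_
    exact Eventually.of_forall fun y => ⟨hxD y, by rw [dist_comm, ← hx y]⟩
  have hxfr : ∀ᶠ y in 𝓝[Dᶜ] p, x y ∈ frontier D :=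
    eventually_nhdsWithin_of_forall fun y hy =>
      mem_frontier_of_nearest hy (hxD y) (by rw [dist_comm, ← hx y])
  have hν : Tendsto (fun y => outwardNormal D (x y)) (𝓝[Dᶜ] p) (𝓝 (outwardNormal D p)) :=
    (hD.continuousOn_outwardNormal p hp).tendsto.comp
      (tendsto_nhdsWithin_iff.mpr ⟨hxt, hxfr⟩)
  have hlim : Tendsto (fun y => Metric.infDist (x y + t • outwardNormal D (x y)) D) (𝓝[Dᶜ] p)
      (𝓝 (Metric.infDist (p + t • outwardNormal D p) D)) :=
    (Metric.continuous_infDist_pt D).continuousAt.tendsto.comp (hxt.add (hν.const_smul t))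
  have hsmall : ∀ᶠ y in 𝓝[Dᶜ] p, Metric.infDist y D < R :=
    (((Metric.continuous_infDist_pt D).tendsto p).mono_left nhdsWithin_le_nhds).eventually_lt_const
      (hp0.trans_lt hR)
  refine tendsto_nhds_unique hlim (tendsto_const_nhds.congr' ?_)
  filter_upwards [hsmall, hxfr, self_mem_nhdsWithin] with y hyR hyfr hyD
  have hnear : dist (x y) y = Metric.infDist y D := by rw [dist_comm, ← hx y]
  have hy := hD.eq_add_smul_outwardNormal hyD (hxD y) hnear
  refine (hU.infDist_add_smul hD.isClosed (hxD y) (hD.norm_outwardNormal hyfr)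
    (hD.infDist_pos hyD) hyR.le ?_ ht htR).symm
  rw [← hy]

theorem dist_add_smul_outwardNormal (hD : IsC2Domain D) (hp : p ∈ frontier D) {t : ℝ}
    (ht : 0 ≤ t) : dist p (p + t • outwardNormal D p) = t := by
  rw [dist_self_add_right, norm_smul, hD.norm_outwardNormal hp, mul_one, Real.norm_of_nonneg ht]

/-- The distance of p + tν_p to D recovers t, and its unique nearest point recovers p. -/
theorem normal_injOn (hD : IsC2Domain D) (hU : UniqueNearest D R) (hR : 0 < R) :
    InjOn (fun z : E k × ℝ => z.1 + z.2 • outwardNormal D z.1) (frontier D ×ˢ Icc 0 R) := by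
  rintro ⟨p, t⟩ ⟨hp, ht⟩ ⟨q, s⟩ ⟨hq, hs⟩ heq
  simp only at heq hp ht hq hs
  have h1 := hD.infDist_add_smul_outwardNormal hU hR hp ht.1 ht.2
  have h2 := hD.infDist_add_smul_outwardNormal hU hR hq hs.1 hs.2
  have hts : t = s := by rw [← h1, ← h2, heq]
  have hpq : p = q := by
    refine hU.eq (y := p + t • outwardNormal D p) (by rw [h1]; exact ht.2)
      (hD.isClosed.frontier_subset hp) ?_ (hD.isClosed.frontier_subset hq) ?_
    · rw [h1, hD.dist_add_smul_outwardNormal hp ht.1]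
    · rw [h1, heq, hD.dist_add_smul_outwardNormal hq hs.1, hts]
  rw [hts, hpq]

theorem tube_diff_eq_image (hD : IsC2Domain D) (hU : UniqueNearest D R) (hR : 0 < R) {r : ℝ}
    (hr : r ≤ R) : tube D r \ D =
      (fun z : E k × ℝ => z.1 + z.2 • outwardNormal D z.1) '' (frontier D ×ˢ Ioc 0 r) := by
  have hne : D.Nonempty := hD.nonempty_interior.mono interior_subset
  ext y
  constructor
  · rintro ⟨hy, hyD⟩
    obtain ⟨q, hq, hqy⟩ := hD.isClosed.exists_infDist_eq_dist hne y
    rw [dist_comm] at hqy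
    exact ⟨(q, Metric.infDist y D), ⟨mem_frontier_of_nearest hyD hq hqy.symm,
      hD.infDist_pos hyD, hy⟩, (hD.eq_add_smul_outwardNormal hyD hq hqy.symm).symm⟩
  · rintro ⟨⟨p, t⟩, ⟨hp, ht⟩, rfl⟩
    have h := hD.infDist_add_smul_outwardNormal hU hR hp ht.1.le (ht.2.trans hr)
    refine ⟨h.trans_le ht.2, fun hmem => ?_⟩
    simp only at hmem ht
    rw [Metric.infDist_zero_of_mem hmem] at h
    exact ht.1.ne h

/-- The maps `p ↦ p + t ν_p` are monotone below the critical radius. -/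
theorem inner_sub_add_smul_nonneg (hD : IsC2Domain D) (hU : UniqueNearest D R) (hR : 0 < R)
    (hp : p ∈ frontier D) (hq : q ∈ frontier D) {t : ℝ} (ht : 0 ≤ t) (htR : t ≤ R) :
    0 ≤ inner ℝ (q - p) (q - p + t • (outwardNormal D q - outwardNormal D p)) := by
  -- The open ball of radius t about p + tν_p misses D, so it does not contain q. Adding this
  -- inequality to the one with p and q exchanged gives monotonicity.
  have key : ∀ {p q : E k}, p ∈ frontier D → q ∈ frontier D →
      2 * t * inner ℝ (q - p) (outwardNormal D p) ≤ ‖q - p‖ ^ 2 := by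
    intro p q hp hq
    have h1 : t ≤ ‖q - p - t • outwardNormal D p‖ := by
      conv_lhs => rw [← hD.infDist_add_smul_outwardNormal hU hR hp ht htR]
      rw [sub_sub, ← dist_eq_norm, dist_comm]
      exact Metric.infDist_le_dist_of_mem (hD.isClosed.frontier_subset hq)
    have h2 := pow_le_pow_left₀ ht h1 2
    rw [norm_sub_sq_real, real_inner_smul_right, norm_smul, hD.norm_outwardNormal hp, mul_one,
      Real.norm_of_nonneg ht] at h2
    linarith
  have h1 := key hp hq
  have h2 := key hq hp
  rw [← neg_sub q p, inner_neg_left, norm_neg] at h2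
  rw [inner_add_right, real_inner_self_eq_norm_sq, real_inner_smul_right, inner_sub_right]
  linarith

end IsC2Domain

theorem exists_uniqueNearest_of_lt_criticalRadius {r : ℝ} (hr0 : 0 ≤ r)
    (hr : ENNReal.ofReal r < criticalRadius D) : ∃ R, r < R ∧ UniqueNearest D R := by
  simp only [criticalRadius, lt_iSup_iff] at hr
  obtain ⟨R, hR, hlt⟩ := hr
  refine ⟨R, ?_, hR⟩
  rw [ENNReal.ofReal, ENNReal.coe_lt_coe] at hlt
  exact (Real.toNNReal_lt_iff_lt_coe hr0).mp hlt

end Domain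

/-! ### Determinants and elementary symmetric polynomials. -/

section LinearAlgebra

theorem prod_one_add_mul_eq_sum_esymm (s : Multiset ℝ) (t : ℝ) :
    (s.map fun x => 1 + t * x).prod = ∑ j ∈ Finset.range (s.card + 1), t ^ j * s.esymm j := by
  have h := congrArg (Polynomial.eval 1) (Multiset.prod_X_add_C_eq_sum_esymm (s.map (t • ·)))
  rw [Polynomial.eval_multiset_prod, Multiset.map_map, Multiset.map_map,
    Polynomial.eval_finsetSum] at h
  have h' : ∀ j, t ^ j * s.esymm j = (s.map (t • ·)).esymm j :=
    fun j => Multiset.pow_smul_esymm t j s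
  simp_rw [h']
  simpa using h

variable {V W : Type*} [NormedAddCommGroup V] [InnerProductSpace ℝ V] [FiniteDimensional ℝ V]

theorem det_one_sub_smul_of_isSymmetric {T : V →ₗ[ℝ] V} (hT : T.IsSymmetric) (t : ℝ) :
    LinearMap.det (1 + t • -T) = ((T.charpoly.roots.map fun x => -x).map fun x => 1 + t * x).prod := by
  rw [hT.roots_charpoly_eq_eigenvalues rfl,
    ← LinearMap.det_toMatrix (hT.eigenvectorBasis rfl).toBasis, map_add, map_smul, map_neg,
    hT.toMatrix_eigenvectorBasis, Module.End.one_eq_id, LinearMap.toMatrix_id]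
  have h : 1 + t • -Matrix.diagonal (RCLike.ofReal ∘ hT.eigenvalues rfl) =
      Matrix.diagonal fun i => 1 + t * -(hT.eigenvalues rfl i) := by
    ext i j
    by_cases hij : i = j
    · subst hij; simp
    · simp [hij]
  rw [h, Matrix.det_diagonal, Multiset.map_map, Multiset.map_map]
  rfl

/-- Sylvester's identity. It serves both to pass from the ambient space to the tangent space and to
move a projection across a determinant. -/
theorem det_one_add_comp_comm [AddCommGroup W] [Module ℝ W] [FiniteDimensional ℝ W]
    (f : V →ₗ[ℝ] W) (g : W →ₗ[ℝ] V) :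
    LinearMap.det (1 + f ∘ₗ g) = LinearMap.det (1 + g ∘ₗ f) := by
  classical
  rw [← LinearMap.det_toMatrix (Module.finBasis ℝ W), ← LinearMap.det_toMatrix (Module.finBasis ℝ V),
    map_add, map_add, Module.End.one_eq_id, Module.End.one_eq_id, LinearMap.toMatrix_id,
    LinearMap.toMatrix_id,
    LinearMap.toMatrix_comp (Module.finBasis ℝ W) (Module.finBasis ℝ V) (Module.finBasis ℝ W),
    LinearMap.toMatrix_comp (Module.finBasis ℝ V) (Module.finBasis ℝ W) (Module.finBasis ℝ V),
    Matrix.det_one_add_mul_comm]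

end LinearAlgebra

/-! ### Flattening the boundary and its tangent vectors. -/

section Chart

variable {k : ℕ} {D : Set (E k)} {p : E k}

/-- Flattening of `∂D` near `p` onto its tangent hyperplane, by a local diffeomorphism `χ` (with
local inverse `G`) whose derivative at `p` is the identity. -/
theorem IsC2Domain.exists_flattening (hD : IsC2Domain D) (hp : p ∈ frontier D) :
    ∃ χ G : E k → E k, HasStrictFDerivAt χ (ContinuousLinearMap.id ℝ (E k)) p ∧
      HasStrictFDerivAt G (ContinuousLinearMap.id ℝ (E k)) 0 ∧ χ p = 0 ∧ G 0 = p ∧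
      (∀ᶠ x in 𝓝 p, G (χ x) = x) ∧ (∀ᶠ z in 𝓝 0, χ (G z) = z) ∧
      ∀ᶠ x in 𝓝 p, (x ∈ frontier D ↔ inner ℝ (outwardNormal D p) (χ x) = 0) := by
  obtain ⟨U, f, h⟩ := hD.exists_definingFunction p hp
  set ν := outwardNormal D p with hν
  have hνf : ν = unitGradient f p := h.outwardNormal_eq hD.isClosed h.mem hp
  have hνn : ‖ν‖ = 1 := hD.norm_outwardNormal hp
  have hνν : inner ℝ ν ν = (1 : ℝ) := by rw [real_inner_self_eq_norm_sq, hνn]; norm_num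
  have hfp := (h.mem_frontier_iff hD.isClosed h.mem).mp hp
  set a := ‖gradient f p‖⁻¹ with ha
  have ha0 : 0 < a := inv_pos.mpr (norm_pos_iff.mpr (h.gradient_ne_zero p h.mem))
  -- The normal coordinate of x − p is replaced by f normalized to have gradient ν at p; this makes
  -- the derivative of χ at p the identity.
  set χ : E k → E k := fun x => (x - p) + (a * f x - inner ℝ ν (x - p)) • ν with hχ
  have hfs : HasStrictFDerivAt f (fderiv ℝ f p) p :=
    (h.contDiffOn.contDiffAt (h.isOpen.mem_nhds h.mem)).hasStrictFDerivAt (by norm_num)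
  have hχd : HasStrictFDerivAt χ
      ((ContinuousLinearEquiv.refl ℝ (E k) : E k ≃L[ℝ] E k) : E k →L[ℝ] E k) p := by
    have h1 : HasStrictFDerivAt (fun x : E k => x - p) (ContinuousLinearMap.id ℝ (E k)) p :=
      (hasStrictFDerivAt_id p).sub_const p
    have h2 : HasStrictFDerivAt (fun x : E k => inner ℝ ν (x - p))
        ((innerSL ℝ ν).comp (ContinuousLinearMap.id ℝ (E k))) p :=
      (innerSL ℝ ν).hasStrictFDerivAt.comp p h1
    have h3 := h1.add (((hfs.const_mul a).sub h2).smul_const ν)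
    refine h3.congr_fderiv ?_
    ext1 w
    have : a * fderiv ℝ f p w - inner ℝ ν w = 0 := by
      rw [← inner_gradient_left, hνf, unitGradient, real_inner_smul_left, sub_self]
    simp [this]
  have hχp : χ p = 0 := by simp [hχ, hfp]
  have hG := hχd.to_localInverse
  have hr := hχd.eventually_right_inverse
  have hGi := hχd.localInverse_apply_image
  rw [hχp] at hG hr hGi
  refine ⟨χ, hχd.localInverse, hχd, hG, hχp, hGi, hχd.eventually_left_inverse, hr, ?_⟩
  filter_upwards [h.isOpen.mem_nhds h.mem] with x hx
  rw [h.mem_frontier_iff hD.isClosed hx, hχ]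
  simp only [inner_add_right, real_inner_smul_right, hνν, mul_one, add_sub_cancel, mul_eq_zero,
    ha0.ne', false_or]

theorem mem_tangentSpace_iff {v : E k} :
    v ∈ tangentSpace D p ↔ inner ℝ (outwardNormal D p) v = 0 :=
  Submodule.mem_orthogonal_singleton_iff_inner_right

/-- Every tangent vector is the velocity of a curve in `∂D`. -/
theorem IsC2Domain.exists_curve (hD : IsC2Domain D) (hp : p ∈ frontier D) {v : E k}
    (hv : v ∈ tangentSpace D p) : ∃ c : ℝ → E k, c 0 = p ∧ HasDerivAt c v 0 ∧
      ∀ᶠ s in 𝓝 0, c s ∈ frontier D := by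
  obtain ⟨χ, G, hχ, hG, hχp, hG0, hl, hr, hfr⟩ := hD.exists_flattening hp
  have hlin : HasDerivAt (fun s : ℝ => s • v) v 0 := by
    simpa using (hasDerivAt_id (0 : ℝ)).smul_const v
  have ht : Tendsto (fun s : ℝ => s • v) (𝓝 0) (𝓝 0) := by
    simpa using hlin.continuousAt.tendsto
  have hGc : Tendsto G (𝓝 0) (𝓝 p) := by
    simpa [hG0] using hG.hasFDerivAt.continuousAt.tendsto
  refine ⟨fun s => G (s • v), by simp [hG0], ?_, ?_⟩
  · have hG' : HasFDerivAt G (ContinuousLinearMap.id ℝ (E k)) ((0 : ℝ) • v) := by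
      simpa using hG.hasFDerivAt
    exact hG'.comp_hasDerivAt (0 : ℝ) hlin
  · filter_upwards [ht.eventually hr, (hGc.comp ht).eventually hfr] with s h1 h2
    simp only [Function.comp_apply] at h2
    rw [h2, h1, real_inner_smul_right, mem_tangentSpace_iff.mp hv, mul_zero]

/-- A derivative within ∂D is determined only on the closed span of the tangent cone; this inclusion
makes its values on tangent vectors well defined. -/
theorem IsC2Domain.tangentSpace_subset_tangentConeAt (hD : IsC2Domain D) (hp : p ∈ frontier D) :
    (tangentSpace D p : Set (E k)) ⊆ tangentConeAt ℝ (frontier D) p := by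
  intro v hv
  obtain ⟨c, hc0, hc, hfr⟩ := hD.exists_curve hp hv
  refine mem_tangentConeAt_of_seq (𝓝[>] (0 : ℝ)) (fun s => s⁻¹) (fun s => c s - p) ?_ ?_ ?_
  · have := hc.continuousAt.tendsto.sub_const p
    rw [hc0, sub_self] at this
    exact this.mono_left nhdsWithin_le_nhds
  · filter_upwards [hfr.filter_mono nhdsWithin_le_nhds] with s hs
    simpa using hs
  · simpa [hc0] using hc.tendsto_slope_zero_right

end Chart

/-! ### The shape operator, its symmetry and the sign of the Jacobian. -/

section ShapeOperator

variable {k : ℕ} {D U : Set (E k)} {f : E k → ℝ} {p q : E k} {N : E k → E k} {N' : E k →L[ℝ] E k}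

/-- The negative of the shape operator, extended by zero to the normal direction. -/
noncomputable def normalDerivative (D : Set (E k)) (p : E k) : E k →ₗ[ℝ] E k :=
  (tangentSpace D p).subtype ∘ₗ (-shapeOperator D p) ∘ₗ
    (tangentSpace D p).orthogonalProjectionOnto.toLinearMap

namespace IsC2Domain

theorem fderivWithin_outwardNormal_apply (hD : IsC2Domain D) (hp : p ∈ frontier D)
    (hN : HasFDerivAt N N' p) (hνN : ∀ᶠ q in 𝓝 p, q ∈ frontier D → outwardNormal D q = N q)
    {v : E k} (hv : v ∈ tangentSpace D p) :
    fderivWithin ℝ (outwardNormal D) (frontier D) p v = N' v := by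
  have h1 : HasFDerivWithinAt (outwardNormal D) N' (frontier D) p := by
    refine hN.hasFDerivWithinAt.congr_of_eventuallyEq ?_ (hνN.self_of_nhds hp)
    filter_upwards [self_mem_nhdsWithin, mem_nhdsWithin_of_mem_nhds hνN] with q hq hq' using hq' hq
  exact h1.differentiableWithinAt.hasFDerivWithinAt.unique_on h1
    (hD.tangentSpace_subset_tangentConeAt hp hv)

theorem neg_shapeOperator_apply (hD : IsC2Domain D) (hp : p ∈ frontier D)
    (hN : HasFDerivAt N N' p) (hνN : ∀ᶠ q in 𝓝 p, q ∈ frontier D → outwardNormal D q = N q)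
    (v : tangentSpace D p) :
    ((-shapeOperator D p) v : E k) = (tangentSpace D p).starProjection (N' v) := by
  rw [← Submodule.coe_orthogonalProjectionOnto_apply, ← hD.fderivWithin_outwardNormal_apply hp hN hνN v.2]
  simp [shapeOperator]

theorem normalDerivative_apply (hD : IsC2Domain D) (hp : p ∈ frontier D)
    (hN : HasFDerivAt N N' p) (hνN : ∀ᶠ q in 𝓝 p, q ∈ frontier D → outwardNormal D q = N q)
    (v : E k) : normalDerivative D p v = (tangentSpace D p).starProjection
      (N' ((tangentSpace D p).starProjection v)) := by
  have := hD.neg_shapeOperator_apply hp hN hνN ((tangentSpace D p).orthogonalProjectionOnto v)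
  rw [Submodule.coe_orthogonalProjectionOnto_apply] at this
  exact this

theorem starProjection_tangentSpace (hD : IsC2Domain D) (hp : p ∈ frontier D) (v : E k) :
    (tangentSpace D p).starProjection v = v - inner ℝ (outwardNormal D p) v • outwardNormal D p := by
  rw [Submodule.starProjection_orthogonal_val,
    Submodule.starProjection_unit_singleton ℝ (hD.norm_outwardNormal hp)]

theorem _root_.GaussTube.IsDefiningFunctionAt.eventually_outwardNormal_eq
    (h : IsDefiningFunctionAt D p U f) (hD : IsClosed D) (hq : q ∈ U) :
    ∀ᶠ x in 𝓝 q, x ∈ frontier D → outwardNormal D x = unitGradient f x := by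
  filter_upwards [h.isOpen.mem_nhds hq] with x hx hxD using h.outwardNormal_eq hD hx hxD

theorem _root_.GaussTube.IsDefiningFunctionAt.contDiffAt_unitGradient
    (h : IsDefiningFunctionAt D p U f) (hq : q ∈ U) : ContDiffAt ℝ 1 (unitGradient f) q :=
  h.contDiffOn_unitGradient.contDiffAt (h.isOpen.mem_nhds hq)

/-- Differentiating the factor 1/‖∇f‖ contributes only a multiple of ∇f, which is orthogonal to
tangent vectors. What remains is the Hessian of f, symmetric because f is C². -/
theorem _root_.GaussTube.IsDefiningFunctionAt.inner_fderiv_unitGradient_comm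
    (h : IsDefiningFunctionAt D p U f) {v w : E k}
    (hv : inner ℝ (unitGradient f p) v = 0) (hw : inner ℝ (unitGradient f p) w = 0) :
    inner ℝ (fderiv ℝ (unitGradient f) p v) w = inner ℝ v (fderiv ℝ (unitGradient f) p w) := by
  have hg : 0 < ‖gradient f p‖⁻¹ := inv_pos.mpr (norm_pos_iff.mpr (h.gradient_ne_zero p h.mem))
  have hU := h.isOpen.mem_nhds h.mem
  have hf : ContDiffAt ℝ 2 f p := h.contDiffOn.contDiffAt hU
  have hsymm : IsSymmSndFDerivAt ℝ f p := hf.isSymmSndFDerivAt (by simp)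
  have hd1 : HasFDerivAt (fderiv ℝ f) (fderiv ℝ (fderiv ℝ f) p) p :=
    ((hf.fderiv_right (m := 1) (by norm_num)).differentiableAt (by norm_num)).hasFDerivAt
  have hgrad : HasFDerivAt (gradient f) (fderiv ℝ (gradient f) p) p :=
    ((h.contDiffOn_gradient.contDiffAt hU).differentiableAt (by norm_num)).hasFDerivAt
  have hhess : ∀ v w : E k,
      inner ℝ w (fderiv ℝ (gradient f) p v) = fderiv ℝ (fderiv ℝ f) p v w := by
    intro v w
    have e1 := (innerSL ℝ w).hasFDerivAt.comp p hgrad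
    have e2 := hd1.clm_apply (hasFDerivAt_const w p)
    have he : (innerSL ℝ w) ∘ gradient f = fun x => fderiv ℝ f x w := by
      ext x
      rw [← inner_gradient_left, real_inner_comm]
      rfl
    rw [he] at e1
    simpa using congrArg (fun L => L v) (e1.unique e2)
  have hc : DifferentiableAt ℝ (fun x => ‖gradient f x‖⁻¹) p :=
    (((h.contDiffOn_gradient.contDiffAt hU).norm ℝ (h.gradient_ne_zero p h.mem)).inv
      (norm_ne_zero_iff.mpr (h.gradient_ne_zero p h.mem))).differentiableAt (by norm_num)
  have hN := (hc.hasFDerivAt.fun_smul hgrad).fderiv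
  have key : ∀ v w : E k, inner ℝ (unitGradient f p) w = 0 →
      inner ℝ (fderiv ℝ (unitGradient f) p v) w =
        ‖gradient f p‖⁻¹ * fderiv ℝ (fderiv ℝ f) p v w := by
    intro v w hw
    rw [unitGradient, real_inner_smul_left, mul_eq_zero, or_iff_right hg.ne'] at hw
    change inner ℝ (fderiv ℝ (fun x => ‖gradient f x‖⁻¹ • gradient f x) p v) w = _
    rw [hN]
    rw [real_inner_comm] at hw
    rw [← hhess, real_inner_comm]
    simp [inner_add_right, real_inner_smul_right, hw]
  rw [key v w hw, real_inner_comm, key w v hv, hsymm v w]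

theorem shapeOperator_isSymmetric (hD : IsC2Domain D) (hp : p ∈ frontier D) :
    (shapeOperator D p).IsSymmetric := by
  obtain ⟨U, f, h⟩ := hD.exists_definingFunction p hp
  have hN := ((h.contDiffAt_unitGradient h.mem).differentiableAt (by norm_num)).hasFDerivAt
  have hA := hD.neg_shapeOperator_apply hp hN (h.eventually_outwardNormal_eq hD.isClosed h.mem)
  have hν := h.outwardNormal_eq hD.isClosed h.mem hp
  have hmem : ∀ v : tangentSpace D p, inner ℝ (unitGradient f p) (v : E k) = 0 := fun v => by
    rw [← hν]; exact mem_tangentSpace_iff.mp v.2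
  intro v w
  rw [← neg_inj, ← inner_neg_left, ← inner_neg_right, ← LinearMap.neg_apply, ← LinearMap.neg_apply,
    Submodule.coe_inner, Submodule.coe_inner, hA, hA, ← Submodule.inner_starProjection_left_eq_right,
    Submodule.inner_starProjection_left_eq_right, Submodule.starProjection_eq_self_iff.mpr v.2,
    Submodule.starProjection_eq_self_iff.mpr w.2]
  exact h.inner_fderiv_unitGradient_comm (hmem v) (hmem w)

theorem finrank_tangentSpace (hD : IsC2Domain D) (hp : p ∈ frontier D) :
    Module.finrank ℝ (tangentSpace D p) + 1 = k := by
  have hne : outwardNormal D p ≠ 0 := by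
    rw [← norm_ne_zero_iff, hD.norm_outwardNormal hp]; exact one_ne_zero
  have : Module.finrank ℝ (Submodule.span ℝ {outwardNormal D p}) +
      Module.finrank ℝ (tangentSpace D p) = Module.finrank ℝ (E k) :=
    Submodule.finrank_add_finrank_orthogonal _
  rw [finrank_span_singleton hne, finrank_euclideanSpace_fin] at this
  omega

/-- By symmetry the characteristic polynomial splits over ℝ, so its roots account for all k − 1
dimensions. -/
theorem card_principalCurvatures (hD : IsC2Domain D) (hp : p ∈ frontier D) :
    (principalCurvatures D p).card + 1 = k := by
  rw [principalCurvatures, Multiset.card_map,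
    (hD.shapeOperator_isSymmetric hp).roots_charpoly_eq_eigenvalues rfl]
  simpa using hD.finrank_tangentSpace hp

theorem det_one_add_smul_normalDerivative (hD : IsC2Domain D) (hp : p ∈ frontier D) (t : ℝ) :
    LinearMap.det (1 + t • normalDerivative D p) =
      ((principalCurvatures D p).map fun x => 1 + t * x).prod := by
  rw [principalCurvatures, ← det_one_sub_smul_of_isSymmetric (hD.shapeOperator_isSymmetric hp),
    normalDerivative, ← LinearMap.smul_comp, det_one_add_comp_comm]
  congr 2
  ext v
  simp

theorem det_one_add_smul_normalDerivative_eq_sum (hD : IsC2Domain D) (hp : p ∈ frontier D) (t : ℝ) :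
    LinearMap.det (1 + t • normalDerivative D p) =
      ∑ j ∈ Finset.range k, t ^ j * (principalCurvatures D p).esymm j := by
  rw [hD.det_one_add_smul_normalDerivative hp, prod_one_add_mul_eq_sum_esymm,
    hD.card_principalCurvatures hp]

theorem continuousOn_normalDerivative (hD : IsC2Domain D) :
    ContinuousOn (fun p => (normalDerivative D p).toContinuousLinearMap) (frontier D) := by
  intro p hp
  obtain ⟨U, f, h⟩ := hD.exists_definingFunction p hp
  set P : E k → E k →L[ℝ] E k := fun q =>
    ContinuousLinearMap.id ℝ (E k) - (innerSL ℝ (outwardNormal D q)).smulRight (outwardNormal D q)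
  have hν : ContinuousWithinAt (outwardNormal D) (frontier D) p := hD.continuousOn_outwardNormal p hp
  have hP : ContinuousWithinAt P (frontier D) p := by
    refine continuousWithinAt_const.sub ?_
    have : Continuous fun v : E k => (innerSL ℝ v).smulRight v :=
      (ContinuousLinearMap.smulRightL ℝ (E k) (E k)).continuous₂.comp
        ((innerSL ℝ).continuous.prodMk continuous_id)
    exact this.continuousAt.comp_continuousWithinAt hν
  have hN : ContinuousWithinAt (fderiv ℝ (unitGradient f)) (frontier D) p :=
    ((h.contDiffAt_unitGradient h.mem).continuousAt_fderiv (by norm_num)).continuousWithinAt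
  refine (hP.clm_comp (hN.clm_comp hP)).congr_of_eventuallyEq_of_mem ?_ hp
  filter_upwards [self_mem_nhdsWithin, mem_nhdsWithin_of_mem_nhds (h.isOpen.mem_nhds h.mem)]
    with q hq hqU
  ext1 v
  rw [LinearMap.coe_toContinuousLinearMap', hD.normalDerivative_apply hq
    ((h.contDiffAt_unitGradient hqU).differentiableAt (by norm_num)).hasFDerivAt
    (h.eventually_outwardNormal_eq hD.isClosed hqU),
    hD.starProjection_tangentSpace hq, hD.starProjection_tangentSpace hq]
  simp only [P, ContinuousLinearMap.comp_apply, sub_apply,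
    ContinuousLinearMap.id_apply, ContinuousLinearMap.smulRight_apply, innerSL_apply_apply]

/-- Below the critical radius no principal curvature is smaller than `-1/t`. -/
theorem one_add_mul_principalCurvature_nonneg {R : ℝ} (hD : IsC2Domain D) (hU : UniqueNearest D R)
    (hR : 0 < R) (hp : p ∈ frontier D) {κ : ℝ} (hκ : κ ∈ principalCurvatures D p) {t : ℝ}
    (ht : 0 ≤ t) (htR : t ≤ R) : 0 ≤ 1 + t * κ := by
  obtain ⟨U, f, h⟩ := hD.exists_definingFunction p hp
  have hN := ((h.contDiffAt_unitGradient h.mem).differentiableAt (by norm_num)).hasFDerivAt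
  have hνN := h.eventually_outwardNormal_eq hD.isClosed h.mem
  rw [principalCurvatures, Multiset.mem_map] at hκ
  obtain ⟨μ, hμ, rfl⟩ := hκ
  have hev := (Module.End.hasEigenvalue_iff_isRoot_charpoly _ _).mpr (Polynomial.isRoot_of_mem_roots hμ)
  obtain ⟨v, hv⟩ := hev.exists_hasEigenvector
  have hSv := hv.apply_eq_smul
  have hv0 : 0 < ‖(v : E k)‖ ^ 2 := by
    have : (v : E k) ≠ 0 := fun h0 => hv.2 (Subtype.ext h0)
    positivity
  have hA := hD.neg_shapeOperator_apply hp hN hνN v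
  rw [LinearMap.neg_apply, hSv] at hA
  obtain ⟨c, hc0, hc, hfr⟩ := hD.exists_curve hp v.2
  have hNc : HasDerivAt (fun s => unitGradient f (c s)) (fderiv ℝ (unitGradient f) p v) 0 := by
    rw [← hc0] at hN
    have := hN.comp_hasDerivAt (0 : ℝ) hc
    rwa [hc0] at this
  have h1 := hc.tendsto_slope_zero_right
  have h2 := hNc.tendsto_slope_zero_right
  -- Monotonicity of p ↦ p + tν_p, divided by the square of the curve parameter, passes to the limit
  -- along a boundary curve whose velocity is the eigenvector v.
  have hlim := h1.inner (h1.add (h2.const_smul t)) (𝕜 := ℝ)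
  have hge : 0 ≤ inner ℝ (v : E k) ((v : E k) + t • fderiv ℝ (unitGradient f) p v) := by
    refine ge_of_tendsto hlim ?_
    have hct : Tendsto c (𝓝 0) (𝓝 p) := by simpa [hc0] using hc.continuousAt.tendsto
    filter_upwards [hfr.filter_mono nhdsWithin_le_nhds,
      (hct.eventually hνN).filter_mono nhdsWithin_le_nhds] with s hs hs'
    simp only [zero_add, hc0]
    rw [← hs' hs, ← hνN.self_of_nhds hp, smul_comm t, ← smul_add, real_inner_smul_left,
      real_inner_smul_right, ← mul_assoc]
    exact mul_nonneg (mul_self_nonneg _) (hD.inner_sub_add_smul_nonneg hU hR hp hs ht htR)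
  have hinner : inner ℝ (v : E k) (fderiv ℝ (unitGradient f) p v) = -μ * ‖(v : E k)‖ ^ 2 := by
    have hPv : (tangentSpace D p).starProjection v = v :=
      Submodule.starProjection_eq_self_iff.mpr v.2
    rw [← congrArg (inner ℝ · (fderiv ℝ (unitGradient f) p v)) hPv,
      Submodule.inner_starProjection_left_eq_right, ← hA]
    simp [real_inner_smul_right]
  rw [inner_add_right, real_inner_smul_right, hinner, real_inner_self_eq_norm_sq] at hge
  by_contra hcon
  rw [not_le] at hcon
  nlinarith

/-- At time R each factor 1 + Rκ is nonnegative; at an earlier time t < R a negative κ gives a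
strictly larger factor, so none vanishes. -/
theorem det_one_add_smul_normalDerivative_pos {R : ℝ} (hD : IsC2Domain D) (hU : UniqueNearest D R)
    (hp : p ∈ frontier D) {t : ℝ} (ht : 0 ≤ t) (htR : t < R) :
    0 < LinearMap.det (1 + t • normalDerivative D p) := by
  rw [hD.det_one_add_smul_normalDerivative hp]
  refine Multiset.prod_pos fun x hx => ?_
  obtain ⟨κ, hκ, rfl⟩ := Multiset.mem_map.mp hx
  have hR : 0 < R := ht.trans_lt htR
  have := hD.one_add_mul_principalCurvature_nonneg hU hR hp hκ hR.le le_rfl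
  rcases le_or_gt 0 κ with h | h
  · positivity
  · nlinarith

end IsC2Domain

end ShapeOperator

/-! ### From local to global inequalities of set functions. -/

section Comparison

/-- A local inequality between two countably additive set functions is a global one. -/
theorem le_mul_of_locally_le_mul {X : Type*} [TopologicalSpace X] [SecondCountableTopology X]
    [MeasurableSpace X] [OpensMeasurableSpace X] {S : Set X} {μ ν : Set X → ℝ≥0∞} {η : ℝ≥0∞}
    (hμ0 : μ ∅ = 0) (hμ : ∀ C : ℕ → Set X, (∀ n, MeasurableSet (C n)) → (∀ n, C n ⊆ S) →
      Pairwise (Function.onFun Disjoint C) → μ (⋃ n, C n) = ∑' n, μ (C n))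
    (hν : ∀ C : ℕ → Set X, (∀ n, MeasurableSet (C n)) → (∀ n, C n ⊆ S) →
      Pairwise (Function.onFun Disjoint C) → ν (⋃ n, C n) = ∑' n, ν (C n))
    (h : ∀ x ∈ S, ∃ O ∈ 𝓝 x, ∀ C ⊆ S ∩ O, MeasurableSet C → μ C ≤ η * ν C)
    {C : Set X} (hC : MeasurableSet C) (hCS : C ⊆ S) : μ C ≤ η * ν C := by
  rcases S.eq_empty_or_nonempty with hS | ⟨x₀, hx₀⟩
  · rw [subset_empty_iff.mp (hCS.trans hS.subset), hμ0]
    exact zero_le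
  choose! O hO hOC using h
  obtain ⟨t, htS, htc, hcov⟩ := TopologicalSpace.countable_cover_nhdsWithin
    (f := fun x => interior (O x)) (s := S)
    fun x hx => mem_nhdsWithin_of_mem_nhds (interior_mem_nhds.mpr (hO x hx))
  have htne : t.Nonempty := by
    obtain ⟨y, hy, -⟩ := mem_iUnion₂.mp (hcov hx₀)
    exact ⟨y, hy⟩
  obtain ⟨u, rfl⟩ := htc.exists_eq_range htne
  rw [biUnion_range] at hcov
  set V : ℕ → Set X := disjointed fun n => interior (O (u n)) with hV
  have hVm : ∀ n, MeasurableSet (V n) :=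
    MeasurableSet.disjointed fun n => isOpen_interior.measurableSet
  have hVU : ⋃ n, V n = ⋃ n, interior (O (u n)) := iUnion_disjointed
  have hCV : C = ⋃ n, C ∩ V n := by
    rw [← inter_iUnion, hVU, inter_eq_left.mpr (hCS.trans hcov)]
  have hd : Pairwise (Function.onFun Disjoint fun n => C ∩ V n) := fun i j hij =>
    (disjoint_disjointed _ hij).mono inter_subset_right inter_subset_right
  rw [hCV, hμ _ (fun n => hC.inter (hVm n)) (fun n => inter_subset_left.trans hCS) hd,
    hν _ (fun n => hC.inter (hVm n)) (fun n => inter_subset_left.trans hCS) hd,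
    ← ENNReal.tsum_mul_left]
  refine ENNReal.tsum_le_tsum fun n => hOC (u n) (htS (mem_range_self n)) _ ?_ (hC.inter (hVm n))
  exact inter_subset_inter hCS ((disjointed_subset _ n).trans interior_subset)

end Comparison

/-! ### Hausdorff measure under Lipschitz maps and volume by slices. -/

section Slices

variable {k : ℕ}

theorem _root_.LipschitzOnWith.euclideanHausdorffMeasure_image_le {X Y : Type*} [EMetricSpace X]
    [EMetricSpace Y] [MeasurableSpace X] [BorelSpace X] [MeasurableSpace Y] [BorelSpace Y] {K : ℝ≥0}
    {f : X → Y} {s : Set X} (h : LipschitzOnWith K f s) (d : ℕ) :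
    μHE[d] (f '' s) ≤ (K : ℝ≥0∞) ^ d * μHE[d] s := by
  simp only [Measure.euclideanHausdorffMeasure_def, Measure.smul_apply]
  have := h.hausdorffMeasure_image_le (Nat.cast_nonneg d)
  rw [ENNReal.rpow_natCast] at this
  rw [ENNReal.smul_def, ENNReal.smul_def, smul_eq_mul, smul_eq_mul, mul_left_comm]
  gcongr

/-- Volume by slices orthogonal to a unit vector, for a region fibred by a map `χ` into the
orthogonal hyperplane. -/
theorem volume_image_add_smul {ν : E k} (hν : ‖ν‖ = 1) {χ : E k → E k} {C : Set (E k × ℝ)}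
    (hχ : ∀ z ∈ C, inner ℝ ν (χ z.1) = 0)
    (hm : MeasurableSet ((fun z : E k × ℝ => χ z.1 + z.2 • ν) '' C)) :
    volume ((fun z : E k × ℝ => χ z.1 + z.2 • ν) '' C) =
      ∫⁻ t : ℝ, μHE[k - 1] (χ '' {x | (x, t) ∈ C}) := by
  have hνν : inner ℝ ν ν = (1 : ℝ) := by rw [real_inner_self_eq_norm_sq, hν]; norm_num
  have hν0 : ν ≠ 0 := by rw [← norm_ne_zero_iff, hν]; exact one_ne_zero
  have h := EuclideanGeometry.euclideanHausdorffMeasure_eq_lintegral (0 : E k) hν0 hm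
  rw [InnerProductSpace.euclideanHausdorffMeasure_eq_volume, finrank_euclideanSpace_fin,
    ← ofReal_norm, hν, ENNReal.ofReal_one, one_mul] at h
  rw [h]
  refine lintegral_congr fun t => ?_
  have hiso : Isometry fun w : E k => w + t • ν := isometry_add_right (t • ν)
  rw [← hiso.euclideanHausdorffMeasure_image (χ '' {x | (x, t) ∈ C})]
  congr 1
  ext w
  have hmem : w ∈ (AffineSubspace.mk' (t • ν +ᵥ (0 : E k)) (Submodule.span ℝ {ν})ᗮ : Set (E k)) ↔
      inner ℝ ν (w - t • ν) = 0 := by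
    rw [SetLike.mem_coe, AffineSubspace.mem_mk', vadd_eq_add, add_zero, vsub_eq_sub,
      Submodule.mem_orthogonal_singleton_iff_inner_right]
  rw [mem_inter_iff, hmem]
  constructor
  · rintro ⟨⟨⟨x, s⟩, hxs, rfl⟩, hin⟩
    have h0 := hχ (x, s) hxs
    simp only at h0 hin
    rw [inner_sub_right, inner_add_right, real_inner_smul_right, real_inner_smul_right, hνν] at hin
    have hst : s = t := by linarith
    subst hst
    exact ⟨χ x, ⟨x, hxs, rfl⟩, rfl⟩
  · rintro ⟨_, ⟨x, hxs, rfl⟩, rfl⟩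
    refine ⟨⟨(x, t), hxs, rfl⟩, ?_⟩
    simp only
    rw [add_sub_cancel_right]
    exact hχ (x, t) hxs

end Slices

/-! ### Surface measure and local factorization of the normal map. -/

section Surface

variable {k : ℕ} {D : Set (E k)} {p : E k}

/-- The surface measure of `∂D`. -/
noncomputable def surfaceMeasure (D : Set (E k)) : Measure (E k) :=
  (μHE[k - 1]).restrict (frontier D)

namespace IsC2Domain

theorem euclideanHausdorffMeasure_tangentSpace_inter_ball_lt_top (hD : IsC2Domain D)
    (hp : p ∈ frontier D) (r : ℝ) :
    μHE[k - 1] ((tangentSpace D p : Set (E k)) ∩ Metric.ball 0 r) < ∞ := by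
  have hk : k - 1 = Module.finrank ℝ (tangentSpace D p) := by
    have := hD.finrank_tangentSpace hp; omega
  have himg : (tangentSpace D p : Set (E k)) ∩ Metric.ball 0 r =
      (Subtype.val : tangentSpace D p → E k) '' Metric.ball 0 r := by
    ext x
    simp [and_comm]
  rw [himg, isometry_subtype_coe.euclideanHausdorffMeasure_image, hk]
  exact measure_ball_lt_top

/-- Near p the boundary is contained in the Lipschitz image of a bounded piece of the tangent
hyperplane. Local finiteness is what makes the product with Lebesgue measure and Fubini's theorem
available. -/
theorem isLocallyFiniteMeasure_surfaceMeasure (hD : IsC2Domain D) :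
    IsLocallyFiniteMeasure (surfaceMeasure D) := by
  refine ⟨fun p => ?_⟩
  by_cases hp : p ∈ frontier D
  · obtain ⟨χ, G, hχ, hG, hχp, hG0, hl, hr, hfr⟩ := hD.exists_flattening hp
    obtain ⟨s, hs, hGs⟩ := hG.exists_lipschitzOnWith_of_nnnorm_lt 2
      ((ContinuousLinearMap.norm_id_le (𝕜 := ℝ) (E := E k)).trans_lt one_lt_two)
    have hχc : Tendsto χ (𝓝 p) (𝓝 0) := hχp ▸ hχ.hasFDerivAt.continuousAt.tendsto
    have hgood : ∀ᶠ x in 𝓝 p, (x ∈ frontier D ↔ inner ℝ (outwardNormal D p) (χ x) = 0) ∧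
        G (χ x) = x ∧ χ x ∈ s ∧ χ x ∈ Metric.ball 0 1 :=
      hfr.and (hl.and ((hχc.eventually hs).and (hχc.eventually (Metric.ball_mem_nhds 0 one_pos))))
    refine ⟨_, hgood, ?_⟩
    rw [surfaceMeasure, Measure.restrict_apply' isClosed_frontier.measurableSet]
    refine lt_of_le_of_lt (b := μHE[k - 1] (G '' (s ∩ ((tangentSpace D p : Set (E k)) ∩
      Metric.ball 0 1)))) (measure_mono ?_) ?_
    · rintro x ⟨⟨h1, h2, h3, h4⟩, hx⟩
      exact ⟨χ x, ⟨h3, mem_tangentSpace_iff.mpr (h1.mp hx), h4⟩, h2⟩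
    · refine ((hGs.mono inter_subset_left).euclideanHausdorffMeasure_image_le (k - 1)).trans_lt ?_
      refine ENNReal.mul_lt_top (by simp) ?_
      exact (measure_mono inter_subset_right).trans_lt
        (hD.euclideanHausdorffMeasure_tangentSpace_inter_ball_lt_top hp 1)
  · refine ⟨(frontier D)ᶜ, isClosed_frontier.isOpen_compl.mem_nhds hp, ?_⟩
    rw [surfaceMeasure, Measure.restrict_apply' isClosed_frontier.measurableSet]
    simp

/-- The normal map `(p, t) ↦ p + t ν_p`. -/
noncomputable def _root_.GaussTube.normalMap (D : Set (E k)) (z : E k × ℝ) : E k :=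
  z.1 + z.2 • outwardNormal D z.1

/-- The Jacobian `det (1 + t ∇ν)` of the normal map. -/
noncomputable def _root_.GaussTube.normalJacobian (D : Set (E k)) (z : E k × ℝ) : ℝ :=
  LinearMap.det (1 + z.2 • normalDerivative D z.1)

theorem continuousOn_normalJacobian (hD : IsC2Domain D) :
    ContinuousOn (normalJacobian D) (frontier D ×ˢ univ) := by
  have h1 : ContinuousOn (fun z : E k × ℝ => ContinuousLinearMap.id ℝ (E k) +
      z.2 • (normalDerivative D z.1).toContinuousLinearMap) (frontier D ×ˢ univ) :=
    continuousOn_const.add (continuousOn_snd.smul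
      (hD.continuousOn_normalDerivative.comp continuousOn_fst fun _ hz => hz.1))
  refine (ContinuousLinearMap.continuous_det.comp_continuousOn h1).congr fun _ _ => rfl

theorem continuousOn_normalMap (hD : IsC2Domain D) :
    ContinuousOn (normalMap D) (frontier D ×ˢ univ) :=
  continuousOn_fst.add (continuousOn_snd.smul
    (hD.continuousOn_outwardNormal.comp continuousOn_fst fun _ hz => hz.1))

/-- Near a boundary point, the normal map factors through a flattening `χ` of `∂D` and a local map
`Φ` of the ambient space whose derivative has the normal Jacobian as determinant. -/
theorem exists_hasStrictFDerivAt_factor (hD : IsC2Domain D) (hp : p ∈ frontier D) (t : ℝ)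
    {χ G : E k → E k} (hG : HasStrictFDerivAt G (ContinuousLinearMap.id ℝ (E k)) 0)
    (hG0 : G 0 = p) :
    ∃ (Φ : E k → E k) (A : E k →L[ℝ] E k),
      HasStrictFDerivAt Φ A (t • outwardNormal D p) ∧ A.det = normalJacobian D (p, t) ∧
      ∀ᶠ x in 𝓝 p, x ∈ frontier D → G (χ x) = x → inner ℝ (outwardNormal D p) (χ x) = 0 →
        ∀ s : ℝ, Φ (χ x + s • outwardNormal D p) = normalMap D (x, s) := by
  obtain ⟨U, f, h⟩ := hD.exists_definingFunction p hp
  set ν := outwardNormal D p with hν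
  set N := unitGradient f with hN
  have hνn : ‖ν‖ = 1 := hD.norm_outwardNormal hp
  have hνν : inner ℝ ν ν = (1 : ℝ) := by rw [real_inner_self_eq_norm_sq, hνn]; norm_num
  have hNp : HasStrictFDerivAt N (fderiv ℝ N p) p :=
    (h.contDiffAt_unitGradient h.mem).hasStrictFDerivAt (by norm_num)
  have hνN := h.eventually_outwardNormal_eq hD.isClosed h.mem
  set P : E k →L[ℝ] E k := (tangentSpace D p).starProjection with hP
  have hPapply : ∀ v, P v = v - inner ℝ ν v • ν := hD.starProjection_tangentSpace hp
  have hPν : P ν = 0 := by rw [hPapply, hνν, one_smul, sub_self]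
  have hPP : ∀ v, P (P v) = P v := fun v => by
    rw [hPapply (P v), show inner ℝ ν (P v) = (0 : ℝ) from
      mem_tangentSpace_iff.mp (Submodule.starProjection_apply_mem _ v), zero_smul, sub_zero]
  have hw₀ : P (t • ν) = 0 := by rw [map_smul, hPν, smul_zero]
  set A : E k →L[ℝ] E k := ContinuousLinearMap.id ℝ (E k) + t • (fderiv ℝ N p).comp P with hA
  -- Read w as tangential part plus height: G carries the first back to ∂D, and the height is then
  -- travelled along the true normal there.
  refine ⟨fun w => G (P w) + inner ℝ ν w • N (G (P w)), A, ?_, ?_, ?_⟩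
  · have h1 : HasStrictFDerivAt (fun w => G (P w)) P (t • ν) := by
      have hG' : HasStrictFDerivAt G (ContinuousLinearMap.id ℝ (E k)) (P (t • ν)) := by rwa [hw₀]
      simpa using hG'.comp (t • ν) P.hasStrictFDerivAt
    have h2 : HasStrictFDerivAt (fun w => N (G (P w))) ((fderiv ℝ N p).comp P) (t • ν) := by
      have hN' : HasStrictFDerivAt N (fderiv ℝ N p) (G (P (t • ν))) := by rwa [hw₀, hG0]
      exact hN'.comp (t • ν) h1
    have h3 : HasStrictFDerivAt (fun w => inner ℝ ν w) (innerSL ℝ ν) (t • ν) :=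
      (innerSL ℝ ν).hasStrictFDerivAt
    refine (h1.add (h3.smul h2)).congr_fderiv ?_
    ext1 v
    simp only [hw₀, hG0, add_apply, smul_apply, hA, ContinuousLinearMap.comp_apply,
      ContinuousLinearMap.id_apply, ContinuousLinearMap.smulRight_apply, innerSL_apply_apply,
      real_inner_smul_right, hνν, mul_one]
    rw [show N p = ν from (hνN.self_of_nhds hp).symm, hPapply v]
    abel
  · have e1 : A.det = LinearMap.det (1 + (t • (fderiv ℝ N p).toLinearMap ∘ₗ P.toLinearMap) ∘ₗ
        P.toLinearMap) := by
      rw [ContinuousLinearMap.det]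
      congr 1
      ext1 v
      simp [hA, hPP]
    rw [e1, det_one_add_comp_comm, normalJacobian]
    congr 1
    ext1 v
    have := hD.normalDerivative_apply hp hNp.hasFDerivAt hνN v
    simp [this, hP]
  · filter_upwards [hνN] with x hx hxD hGx hxν s
    have hPx : P (χ x + s • ν) = χ x := by
      rw [map_add, map_smul, hPν, smul_zero, add_zero, hPapply, hxν, zero_smul, sub_zero]
    rw [hPx, hGx, inner_add_right, hxν, real_inner_smul_right, hνν, zero_add, mul_one, normalMap,
      hx hxD]

end IsC2Domain

end Surface

/-! ### Area formula and integration over the tube. -/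

section Tube

variable {k : ℕ} {D : Set (E k)} {p : E k}

namespace IsC2Domain

theorem surfaceMeasure_prod_apply (hD : IsC2Domain D) {C : Set (E k × ℝ)} (hC : MeasurableSet C)
    (hCD : ∀ z ∈ C, z.1 ∈ frontier D) :
    ((surfaceMeasure D).prod volume) C = ∫⁻ t : ℝ, μHE[k - 1] {x | (x, t) ∈ C} := by
  have := hD.isLocallyFiniteMeasure_surfaceMeasure
  rw [Measure.prod_apply_symm hC]
  refine lintegral_congr fun t => ?_
  rw [surfaceMeasure, Measure.restrict_apply' isClosed_frontier.measurableSet, inter_eq_left.mpr]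
  · rfl
  · exact fun x hx => hCD (x, t) hx

/-- Up to a factor close to one, the product of the surface measure and the length is the volume
after flattening. -/
theorem exists_nhds_flattening_comparable (hD : IsC2Domain D) (hp : p ∈ frontier D)
    {η : ℝ≥0} (hη : 1 < η) {χ G : E k → E k}
    (hχ : HasStrictFDerivAt χ (ContinuousLinearMap.id ℝ (E k)) p)
    (hG : HasStrictFDerivAt G (ContinuousLinearMap.id ℝ (E k)) 0) (hχp : χ p = 0)
    (hl : ∀ᶠ x in 𝓝 p, G (χ x) = x)
    (hfr : ∀ᶠ x in 𝓝 p, (x ∈ frontier D ↔ inner ℝ (outwardNormal D p) (χ x) = 0)) :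
    ∃ V ∈ 𝓝 p, ∀ C : Set (E k × ℝ), MeasurableSet C → C ⊆ (frontier D ∩ V) ×ˢ univ →
      volume ((fun z : E k × ℝ => χ z.1 + z.2 • outwardNormal D p) '' C) ≤
        η * ((surfaceMeasure D).prod volume) C ∧
      ((surfaceMeasure D).prod volume) C ≤
        η * volume ((fun z : E k × ℝ => χ z.1 + z.2 • outwardNormal D p) '' C) := by
  set ν := outwardNormal D p with hν
  have hνn : ‖ν‖ = 1 := hD.norm_outwardNormal hp
  have hνν : inner ℝ ν ν = (1 : ℝ) := by rw [real_inner_self_eq_norm_sq, hνn]; norm_num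
  -- Both χ and its inverse have derivative the identity, so near p they are a-Lipschitz for any a >
  -- 1 and distort (k − 1)-dimensional measure by at most a^(k−1).
  obtain ⟨a, ha1, haη⟩ : ∃ a : ℝ≥0, 1 < a ∧ a ^ (k - 1) ≤ η := by
    have hc : Tendsto (fun a : ℝ≥0 => a ^ (k - 1)) (𝓝[>] 1) (𝓝 (1 ^ (k - 1))) :=
      ((continuous_pow (k - 1)).tendsto 1).mono_left nhdsWithin_le_nhds
    rw [one_pow] at hc
    obtain ⟨a, h1, h2⟩ := ((hc.eventually_lt_const hη).and self_mem_nhdsWithin).exists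
    exact ⟨a, h2, h1.le⟩
  have haη' : (a : ℝ≥0∞) ^ (k - 1) ≤ η := by exact_mod_cast haη
  have hid : ‖ContinuousLinearMap.id ℝ (E k)‖₊ < a :=
    (ContinuousLinearMap.norm_id_le (𝕜 := ℝ) (E := E k)).trans_lt ha1
  obtain ⟨s, hs, hχs⟩ := hχ.exists_lipschitzOnWith_of_nnnorm_lt a hid
  obtain ⟨s', hs', hGs⟩ := hG.exists_lipschitzOnWith_of_nnnorm_lt a hid
  have hχc : Tendsto χ (𝓝 p) (𝓝 0) := hχp ▸ hχ.hasFDerivAt.continuousAt.tendsto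
  refine ⟨_, hl.and (hfr.and ((hχc.eventually hs').and hs)), fun C hC hCV => ?_⟩
  have hCG : ∀ z ∈ C, G (χ z.1) = z.1 := fun z hz => (hCV hz).1.2.1
  have hCχ : ∀ z ∈ C, inner ℝ ν (χ z.1) = 0 := fun z hz => (hCV hz).1.2.2.1.mp (hCV hz).1.1
  have hCs' : ∀ z ∈ C, χ z.1 ∈ s' := fun z hz => (hCV hz).1.2.2.2.1
  have hCs : ∀ z ∈ C, z.1 ∈ s := fun z hz => (hCV hz).1.2.2.2.2
  have hcont : ContinuousOn (fun z : E k × ℝ => χ z.1 + z.2 • ν) C :=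
    (hχs.continuousOn.comp continuousOn_fst hCs).add (continuousOn_snd.smul continuousOn_const)
  have hinj : InjOn (fun z : E k × ℝ => χ z.1 + z.2 • ν) C := by
    intro z hz w hw hzw
    simp only at hzw
    have h1 := congrArg (inner ℝ ν) hzw
    rw [inner_add_right, inner_add_right, hCχ z hz, hCχ w hw, real_inner_smul_right,
      real_inner_smul_right, hνν, zero_add, zero_add, mul_one, mul_one] at h1
    rw [h1, add_left_inj] at hzw
    exact Prod.ext (by rw [← hCG z hz, ← hCG w hw, hzw]) h1
  rw [volume_image_add_smul hνn hCχ (hC.image_of_continuousOn_injOn hcont hinj),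
    hD.surfaceMeasure_prod_apply hC fun z hz => (hCV hz).1.1,
    ← lintegral_const_mul' _ _ ENNReal.coe_ne_top, ← lintegral_const_mul' _ _ ENNReal.coe_ne_top]
  constructor
  · refine lintegral_mono fun t => ?_
    refine ((hχs.mono ?_).euclideanHausdorffMeasure_image_le (k - 1)).trans (by gcongr)
    exact fun x hx => hCs _ hx
  · refine lintegral_mono fun t => ?_
    have himg : {x | (x, t) ∈ C} = G '' (χ '' {x | (x, t) ∈ C}) := by
      rw [← image_comp]
      ext x
      constructor
      · exact fun hx => ⟨x, hx, hCG _ hx⟩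
      · rintro ⟨y, hy, rfl⟩
        rw [Function.comp_apply, hCG _ hy]
        exact hy
    conv_lhs => rw [himg]
    refine ((hGs.mono ?_).euclideanHausdorffMeasure_image_le (k - 1)).trans (by gcongr)
    rintro _ ⟨x, hx, rfl⟩
    exact hCs' _ hx

/-- Three errors of ratio η multiply to η³: the flattening changes product measure to volume, the
map Φ scales volume by nearly the constant c, and the Jacobian nearby is nearly c. -/
theorem exists_nhds_volume_image_comparable (hD : IsC2Domain D) (hp : p ∈ frontier D) {t : ℝ}
    (hJ : 0 < normalJacobian D (p, t)) {η : ℝ≥0} (hη : 1 < η) :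
    ∃ O ∈ 𝓝 (p, t), ∀ C : Set (E k × ℝ), MeasurableSet C → C ⊆ (frontier D ×ˢ univ) ∩ O →
      volume (normalMap D '' C) ≤ (η ^ 3 : ℝ≥0) *
        ∫⁻ z in C, ENNReal.ofReal (normalJacobian D z) ∂((surfaceMeasure D).prod volume) ∧
      ∫⁻ z in C, ENNReal.ofReal (normalJacobian D z) ∂((surfaceMeasure D).prod volume) ≤
        (η ^ 3 : ℝ≥0) * volume (normalMap D '' C) := by
  set ν := outwardNormal D p with hν
  set c : ℝ≥0 := (normalJacobian D (p, t)).toNNReal with hc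
  have hc0 : 0 < c := Real.toNNReal_pos.mpr hJ
  have hη0 : 0 < η := one_pos.trans hη
  have hcη : c < η * c := lt_mul_of_one_lt_left hc0 hη
  have hcη' : η⁻¹ * c < c := mul_lt_of_lt_one_left hc0 (inv_lt_one_of_one_lt₀ hη)
  obtain ⟨χ, G, hχ, hG, hχp, hG0, hl, hr, hfr⟩ := hD.exists_flattening hp
  obtain ⟨V, hV, hVC⟩ := hD.exists_nhds_flattening_comparable hp hη hχ hG hχp hl hfr
  obtain ⟨Φ, A, hΦ, hA, hΦχ⟩ := hD.exists_hasStrictFDerivAt_factor (χ := χ) hp t hG hG0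
  have hdet : ENNReal.ofReal |A.det| = c := by rw [hA, abs_of_pos hJ]; rfl
  obtain ⟨δ, ⟨hδ1, hδ2⟩, hδ0⟩ := (((addHaar_image_le_mul_of_det_lt volume A (m := η * c)
    (by rw [hdet]; exact_mod_cast hcη)).and (mul_le_addHaar_image_of_lt_det volume A (m := η⁻¹ * c)
    (by rw [hdet]; exact_mod_cast hcη'))).and self_mem_nhdsWithin).exists
  obtain ⟨s, hs, hΦs⟩ := hΦ.approximates_deriv_on_nhds (c := δ) (Or.inr hδ0)
  have hJc : ContinuousWithinAt (fun z => (normalJacobian D z).toNNReal) (frontier D ×ˢ univ) (p, t) :=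
    (continuous_real_toNNReal.comp_continuousOn hD.continuousOn_normalJacobian) _ ⟨hp, mem_univ _⟩
  have hJ1 := eventually_nhdsWithin_iff.mp (hJc.eventually_lt_const hcη)
  have hJ2 := eventually_nhdsWithin_iff.mp (hJc.eventually_const_lt hcη')
  have hθ : Tendsto (fun z : E k × ℝ => χ z.1 + z.2 • ν) (𝓝 (p, t)) (𝓝 (t • ν)) := by
    have h1 : ContinuousAt (fun z : E k × ℝ => χ z.1 + z.2 • ν) (p, t) :=
      (ContinuousAt.comp (f := Prod.fst) (g := χ) hχ.hasFDerivAt.continuousAt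
        continuousAt_fst).add (continuousAt_snd.smul continuousAt_const)
    have h2 := h1.tendsto
    simp only [hχp, zero_add] at h2
    exact h2
  have hfst : Tendsto (Prod.fst : E k × ℝ → E k) (𝓝 (p, t)) (𝓝 p) := continuousAt_fst
  refine ⟨_, (hfst.eventually (hl.and (hfr.and (hΦχ.and hV)))).and
    ((hθ.eventually hs).and (hJ1.and hJ2)), fun C hC hCO => ?_⟩
  set θ : E k × ℝ → E k := fun z => χ z.1 + z.2 • ν with hθdef
  have himg : normalMap D '' C = Φ '' (θ '' C) := by
    rw [image_image]
    refine image_congr fun z hz => ?_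
    obtain ⟨⟨hzD, -⟩, ⟨⟨h1, h2, h3, -⟩, -⟩⟩ := hCO hz
    exact (h3 hzD h1 (h2.mp hzD) z.2).symm
  have hθs : ApproximatesLinearOn Φ A (θ '' C) δ := by
    refine hΦs.mono_set ?_
    rintro _ ⟨z, hz, rfl⟩
    exact (hCO hz).2.2.1
  obtain ⟨hV1, hV2⟩ := hVC C hC fun z hz => ⟨⟨(hCO hz).1.1, (hCO hz).2.1.2.2.2⟩, mem_univ _⟩
  have hΦ1 := hδ1 _ _ hθs
  have hΦ2 := hδ2 _ _ hθs
  rw [← himg] at hΦ1 hΦ2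
  set m := ((surfaceMeasure D).prod volume) C
  set v := volume (θ '' C)
  have hI1 : ∫⁻ z in C, ENNReal.ofReal (normalJacobian D z) ∂((surfaceMeasure D).prod volume) ≤
      ((η * c : ℝ≥0) : ℝ≥0∞) * m := by
    rw [← setLIntegral_const]
    refine setLIntegral_mono' hC fun z hz => ?_
    exact ENNReal.coe_le_coe.mpr ((hCO hz).2.2.2.1 (hCO hz).1).le
  have hI2 : ((η⁻¹ * c : ℝ≥0) : ℝ≥0∞) * m ≤
      ∫⁻ z in C, ENNReal.ofReal (normalJacobian D z) ∂((surfaceMeasure D).prod volume) := by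
    rw [← setLIntegral_const]
    refine setLIntegral_mono' hC fun z hz => ?_
    exact ENNReal.coe_le_coe.mpr ((hCO hz).2.2.2.2 (hCO hz).1).le
  have hfac : η * c * η = η ^ 3 * (η⁻¹ * c) := by
    rw [pow_succ, mul_assoc (η ^ 2), mul_inv_cancel_left₀ hη0.ne']; ring
  constructor
  · calc volume (normalMap D '' C) ≤ ((η * c : ℝ≥0) : ℝ≥0∞) * v := hΦ1
      _ ≤ ((η * c : ℝ≥0) : ℝ≥0∞) * (η * m) := by gcongr
      _ = ((η ^ 3 : ℝ≥0) : ℝ≥0∞) * (((η⁻¹ * c : ℝ≥0) : ℝ≥0∞) * m) := by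
        rw [← mul_assoc, ← mul_assoc, ← ENNReal.coe_mul, ← ENNReal.coe_mul, hfac]
      _ ≤ _ := by gcongr
  · calc _ ≤ ((η * c : ℝ≥0) : ℝ≥0∞) * m := hI1
      _ ≤ ((η * c : ℝ≥0) : ℝ≥0∞) * (η * v) := by gcongr
      _ = ((η ^ 3 : ℝ≥0) : ℝ≥0∞) * (((η⁻¹ * c : ℝ≥0) : ℝ≥0∞) * v) := by
        rw [← mul_assoc, ← mul_assoc, ← ENNReal.coe_mul, ← ENNReal.coe_mul, hfac]
      _ ≤ _ := by gcongr

variable {R r : ℝ}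

/-- An injective continuous image of a Borel set is Borel (Lusin–Souslin). -/
theorem measurableSet_normalMap_image (hD : IsC2Domain D) (hU : UniqueNearest D R) (hR : 0 < R)
    {C : Set (E k × ℝ)} (hC : MeasurableSet C) (hCR : C ⊆ frontier D ×ˢ Icc 0 R) :
    MeasurableSet (normalMap D '' C) :=
  hC.image_of_continuousOn_injOn
    (hD.continuousOn_normalMap.mono (hCR.trans (prod_mono_right (subset_univ _))))
    ((hD.normal_injOn hU hR).mono hCR)

/-- Area formula for the normal map below the critical radius. -/
theorem volume_normalMap_image (hD : IsC2Domain D) (hU : UniqueNearest D R) (hR : 0 < R)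
    {C : Set (E k × ℝ)} (hC : MeasurableSet C) (hCR : C ⊆ frontier D ×ˢ Ico 0 R) :
    volume (normalMap D '' C) =
      ∫⁻ z in C, ENNReal.ofReal (normalJacobian D z) ∂((surfaceMeasure D).prod volume) := by
  have hsub : frontier D ×ˢ Ico 0 R ⊆ frontier D ×ˢ Icc 0 R := prod_mono_right Ico_subset_Icc_self
  -- Injectivity of the normal map is what makes the volume of the image countably additive.
  have hμ : ∀ C : ℕ → Set (E k × ℝ), (∀ n, MeasurableSet (C n)) →
      (∀ n, C n ⊆ frontier D ×ˢ Ico 0 R) → Pairwise (Function.onFun Disjoint C) →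
      volume (normalMap D '' ⋃ n, C n) = ∑' n, volume (normalMap D '' C n) := by
    intro C hCm hCs hCd
    rw [image_iUnion]
    refine measure_iUnion (fun i j hij => ?_)
      fun n => hD.measurableSet_normalMap_image hU hR (hCm n) ((hCs n).trans hsub)
    refine disjoint_left.mpr ?_
    rintro _ ⟨z, hz, rfl⟩ ⟨w, hw, hzw⟩
    have := hD.normal_injOn hU hR (hsub (hCs j hw)) (hsub (hCs i hz)) hzw
    exact disjoint_left.mp (hCd hij) hz (this ▸ hw)
  have hν : ∀ C : ℕ → Set (E k × ℝ), (∀ n, MeasurableSet (C n)) →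
      (∀ n, C n ⊆ frontier D ×ˢ Ico 0 R) → Pairwise (Function.onFun Disjoint C) →
      ∫⁻ z in ⋃ n, C n, ENNReal.ofReal (normalJacobian D z) ∂((surfaceMeasure D).prod volume) =
        ∑' n, ∫⁻ z in C n, ENNReal.ofReal (normalJacobian D z) ∂((surfaceMeasure D).prod volume) :=
    fun C hCm _ hCd => lintegral_iUnion hCm hCd _
  have hloc : ∀ η : ℝ≥0, 1 < η → ∀ z ∈ frontier D ×ˢ Ico 0 R, ∃ O ∈ 𝓝 z,
      ∀ C ⊆ (frontier D ×ˢ Ico 0 R) ∩ O, MeasurableSet C →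
      volume (normalMap D '' C) ≤ (η ^ 3 : ℝ≥0) *
        ∫⁻ z in C, ENNReal.ofReal (normalJacobian D z) ∂((surfaceMeasure D).prod volume) ∧
      ∫⁻ z in C, ENNReal.ofReal (normalJacobian D z) ∂((surfaceMeasure D).prod volume) ≤
        (η ^ 3 : ℝ≥0) * volume (normalMap D '' C) := by
    rintro η hη ⟨p, t⟩ ⟨hp, ht⟩
    obtain ⟨O, hO, h⟩ := hD.exists_nhds_volume_image_comparable hp
      (hD.det_one_add_smul_normalDerivative_pos hU hp ht.1 ht.2) hη
    exact ⟨O, hO, fun C hC hCm => h C hCm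
      (hC.trans (inter_subset_inter_left _ (prod_mono_right (subset_univ _))))⟩
  have key : ∀ η : ℝ≥0, 1 < η → volume (normalMap D '' C) ≤ (η ^ 3 : ℝ≥0) *
        ∫⁻ z in C, ENNReal.ofReal (normalJacobian D z) ∂((surfaceMeasure D).prod volume) ∧
      ∫⁻ z in C, ENNReal.ofReal (normalJacobian D z) ∂((surfaceMeasure D).prod volume) ≤
        (η ^ 3 : ℝ≥0) * volume (normalMap D '' C) := by
    intro η hη
    constructor
    · exact le_mul_of_locally_le_mul
        (μ := fun C => volume (normalMap D '' C))
        (ν := fun C => ∫⁻ z in C, ENNReal.ofReal (normalJacobian D z)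
          ∂((surfaceMeasure D).prod volume)) (by simp) hμ hν (fun z hz => by
        obtain ⟨O, hO, h⟩ := hloc η hη z hz
        exact ⟨O, hO, fun C hC hCm => (h C hC hCm).1⟩) hC hCR
    · exact le_mul_of_locally_le_mul
        (ν := fun C => volume (normalMap D '' C))
        (μ := fun C => ∫⁻ z in C, ENNReal.ofReal (normalJacobian D z)
          ∂((surfaceMeasure D).prod volume)) (by simp) hν hμ (fun z hz => by
        obtain ⟨O, hO, h⟩ := hloc η hη z hz
        exact ⟨O, hO, fun C hC hCm => (h C hC hCm).2⟩) hC hCR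
  have hlim : ∀ a b : ℝ≥0∞, (∀ η : ℝ≥0, 1 < η → a ≤ (η ^ 3 : ℝ≥0) * b) → a ≤ b := by
    intro a b h
    have ht : Tendsto (fun η : ℝ≥0 => ((η ^ 3 : ℝ≥0) : ℝ≥0∞) * b) (𝓝[>] 1) (𝓝 (1 * b)) := by
      refine ENNReal.Tendsto.mul_const ?_ (Or.inl one_ne_zero)
      have : Tendsto (fun η : ℝ≥0 => ((η ^ 3 : ℝ≥0) : ℝ≥0∞)) (𝓝 1) (𝓝 (((1 : ℝ≥0) ^ 3 : ℝ≥0) : ℝ≥0∞)) :=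
        (ENNReal.continuous_coe.comp (continuous_pow 3)).tendsto 1
      rw [one_pow, ENNReal.coe_one] at this
      exact this.mono_left nhdsWithin_le_nhds
    rw [one_mul] at ht
    exact ge_of_tendsto ht (eventually_nhdsWithin_of_forall fun η hη => h η hη)
  exact le_antisymm (hlim _ _ fun η hη => (key η hη).1) (hlim _ _ fun η hη => (key η hη).2)

/-- Integration over the tube in normal coordinates. -/
theorem lintegral_tube_diff (hD : IsC2Domain D) (hU : UniqueNearest D R) (hR : 0 < R) (hr : r < R)
    {F : E k → ℝ≥0∞} (hF : Measurable F) :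
    ∫⁻ y in tube D r \ D, F y =
      ∫⁻ z in frontier D ×ˢ Ioc 0 r, ENNReal.ofReal (normalJacobian D z) * F (normalMap D z)
        ∂((surfaceMeasure D).prod volume) := by
  set S := frontier D ×ˢ Ioc 0 r with hS
  have hSm : MeasurableSet S := isClosed_frontier.measurableSet.prod measurableSet_Ioc
  have hSR : S ⊆ frontier D ×ˢ Ico 0 R :=
    prod_mono_right fun t ht => ⟨ht.1.le, ht.2.trans_lt hr⟩
  have hSU : S ⊆ frontier D ×ˢ univ := prod_mono_right (subset_univ _)
  have hΨ : AEMeasurable (normalMap D) (((surfaceMeasure D).prod volume).restrict S) :=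
    (hD.continuousOn_normalMap.mono hSU).aemeasurable hSm
  have hJ : AEMeasurable (fun z => ENNReal.ofReal (normalJacobian D z))
      (((surfaceMeasure D).prod volume).restrict S) :=
    ((hD.continuousOn_normalJacobian.mono hSU).aemeasurable hSm).ennreal_ofReal
  set M := (((surfaceMeasure D).prod volume).restrict S).withDensity
    fun z => ENNReal.ofReal (normalJacobian D z) with hM
  have hΨM : AEMeasurable (normalMap D) M := hΨ.mono_ac (withDensity_absolutelyContinuous _ _)
  have htube : tube D r \ D = normalMap D '' S := hD.tube_diff_eq_image hU hR hr.le
  -- The area formula applied to preimages says that Lebesgue measure on the outer tube is the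
  -- pushforward of the Jacobian-weighted product measure.
  have hmap : volume.restrict (tube D r \ D) = M.map (normalMap D) := by
    ext B hB
    have hm : MeasurableSet (normalMap D ⁻¹' B ∩ S) := by
      have h1 : Measurable (S.domRestrict (normalMap D)) :=
        (hD.continuousOn_normalMap.mono hSU).domRestrict.measurable
      have h2 := hSm.subtype_image (h1 hB)
      rwa [domRestrict_eq, preimage_comp, Subtype.image_preimage_coe, inter_comm] at h2
    have := hD.isLocallyFiniteMeasure_surfaceMeasure
    rw [Measure.restrict_apply hB, htube, inter_comm, ← image_inter_preimage, inter_comm,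
      hD.volume_normalMap_image hU hR hm (inter_subset_right.trans hSR),
      Measure.map_apply_of_aemeasurable hΨM hB, hM, withDensity_apply',
      Measure.restrict_restrict' hSm]
  rw [hmap, lintegral_map' hF.aemeasurable hΨM, hM]
  exact lintegral_withDensity_eq_lintegral_mul₀ hJ (hF.comp_aemeasurable hΨ)

end IsC2Domain

end Tube

/-! ### Taylor expansion of moments. -/

section Taylor

/-- Taylor's bound with the factorial in the remainder discarded. The case n = 0, a bare bound on a,
is needed later for integrability and for orders j ≥ N. -/
theorem abs_sub_taylor_le {a : ℝ → ℝ} (ha : ContDiff ℝ ⊤ a) {n : ℕ} {B : ℝ}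
    (hB : ∀ t ∈ Icc (0 : ℝ) 1, |iteratedDeriv n a t| ≤ B) {t : ℝ} (ht : t ∈ Icc (0 : ℝ) 1) :
    |a t - ∑ i ∈ Finset.range n, iteratedDeriv i a 0 / i.factorial * t ^ i| ≤ B * t ^ n := by
  have hB0 : 0 ≤ B := (abs_nonneg _).trans (hB 0 ⟨le_rfl, zero_le_one⟩)
  cases n with
  | zero => simpa using hB t ht
  | succ n =>
    have hd : ∀ (m : ℕ), ∀ x ∈ Icc (0 : ℝ) 1,
        iteratedDerivWithin m a (Icc 0 1) x = iteratedDeriv m a x := fun m x hx =>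
      iteratedDerivWithin_eq_iteratedDeriv (uniqueDiffOn_Icc one_pos)
        ((ha.of_le le_top).contDiffAt) hx
    have h := taylor_mean_remainder_bound (n := n) zero_le_one
      ((ha.of_le le_top).contDiffOn) ht fun y hy => by
        rw [hd _ y hy, Real.norm_eq_abs]; exact hB y hy
    rw [taylor_within_apply, Real.norm_eq_abs, sub_zero] at h
    have hsum : ∑ i ∈ Finset.range (n + 1), iteratedDeriv i a 0 / i.factorial * t ^ i =
        ∑ i ∈ Finset.range (n + 1), (((i.factorial : ℝ))⁻¹ * t ^ i) •
          iteratedDerivWithin i a (Icc 0 1) 0 := by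
      refine Finset.sum_congr rfl fun i _ => ?_
      rw [hd i 0 ⟨le_rfl, zero_le_one⟩, smul_eq_mul]; ring
    rw [hsum]
    refine h.trans (div_le_self (mul_nonneg hB0 (pow_nonneg ht.1 _)) ?_)
    exact_mod_cast Nat.one_le_iff_ne_zero.mpr n.factorial_ne_zero

/-- Expansion of the moments `∫₀ʳ tʲ a(t) dt` in powers of `r`. -/
theorem abs_integral_pow_mul_sub_le {a : ℝ → ℝ} (ha : ContDiff ℝ ⊤ a) (j n : ℕ) {B : ℝ}
    (hB : ∀ t ∈ Icc (0 : ℝ) 1, |iteratedDeriv n a t| ≤ B) {r : ℝ} (hr : r ∈ Icc (0 : ℝ) 1) :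
    |(∫ t in (0 : ℝ)..r, t ^ j * a t) -
      ∑ i ∈ Finset.range n, iteratedDeriv i a 0 / i.factorial * (r ^ (i + j + 1) / (i + j + 1))| ≤
      B * r ^ (n + j + 1) := by
  have hsum : ∑ i ∈ Finset.range n, iteratedDeriv i a 0 / i.factorial *
      (r ^ (i + j + 1) / (i + j + 1)) = ∫ t in (0 : ℝ)..r, t ^ j *
        ∑ i ∈ Finset.range n, iteratedDeriv i a 0 / i.factorial * t ^ i := by
    have : ∀ t : ℝ, t ^ j * ∑ i ∈ Finset.range n, iteratedDeriv i a 0 / i.factorial * t ^ i =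
        ∑ i ∈ Finset.range n, iteratedDeriv i a 0 / i.factorial * t ^ (i + j) := fun t => by
      rw [Finset.mul_sum]
      exact Finset.sum_congr rfl fun i _ => by rw [pow_add]; ring
    simp_rw [this]
    rw [intervalIntegral.integral_finsetSum
      fun i _ => (by fun_prop : Continuous _).intervalIntegrable _ _]
    refine Finset.sum_congr rfl fun i _ => ?_
    rw [intervalIntegral.integral_const_mul, integral_pow]
    simp
  have hcont := ha.continuous
  rw [hsum, ← intervalIntegral.integral_sub ((by fun_prop : Continuous _).intervalIntegrable _ _)
    ((by fun_prop : Continuous _).intervalIntegrable _ _)]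
  have hB0 : 0 ≤ B := (abs_nonneg _).trans (hB 0 ⟨le_rfl, zero_le_one⟩)
  have h := intervalIntegral.norm_integral_le_of_norm_le_const (a := 0) (b := r)
    (C := B * r ^ (n + j))
    (f := fun t => t ^ j * a t -
      t ^ j * ∑ i ∈ Finset.range n, iteratedDeriv i a 0 / i.factorial * t ^ i) fun t ht => by
    rw [uIoc_of_le hr.1] at ht
    rw [← mul_sub, Real.norm_eq_abs, abs_mul, abs_of_nonneg (pow_nonneg ht.1.le j), pow_add,
      ← mul_assoc, mul_comm (B * r ^ n)]
    have h1 := abs_sub_taylor_le ha hB (t := t) ⟨ht.1.le, ht.2.trans hr.2⟩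
    have h2 : t ^ n ≤ r ^ n := pow_le_pow_left₀ ht.1.le ht.2 n
    have h3 : t ^ j ≤ r ^ j := pow_le_pow_left₀ ht.1.le ht.2 j
    exact mul_le_mul h3 (h1.trans (mul_le_mul_of_nonneg_left h2 hB0)) (abs_nonneg _)
      (pow_nonneg hr.1 j)
  rw [Real.norm_eq_abs, sub_zero, abs_of_nonneg hr.1, mul_assoc, ← pow_succ] at h
  exact h

end Taylor

/-! ### The Gaussian density along lines and its decay. -/

section Gaussian

variable {k : ℕ}

theorem gaussianDensity_add_smul {x v : E k} (hv : ‖v‖ = 1) (t : ℝ) :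
    gaussianDensity k (x + t • v) = (2 * Real.pi) ^ (-(k : ℝ) / 2) *
      Real.exp ((inner ℝ x v ^ 2 - ‖x‖ ^ 2) / 2) * Real.exp (-((inner ℝ x v + t) ^ 2 / 2)) := by
  rw [gaussianDensity, mul_assoc, ← Real.exp_add, norm_add_sq_real, real_inner_smul_right, norm_smul,
    hv, mul_one, Real.norm_eq_abs, sq_abs]
  congr 2
  ring

theorem contDiff_gaussianDensity_line (x v : E k) :
    ContDiff ℝ ⊤ fun t : ℝ => gaussianDensity k (x + t • v) := by
  unfold gaussianDensity
  have h : ContDiff ℝ ⊤ fun t : ℝ => ‖x + t • v‖ ^ 2 :=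
    (contDiff_const.add (contDiff_id.smul contDiff_const)).norm_sq ℝ
  exact contDiff_const.mul (Real.contDiff_exp.comp (h.neg.div_const 2))

/-- Completing the square leaves a constant times a one-dimensional Gaussian in ⟨x, v⟩ + t, to which
Rodrigues' formula applies. -/
theorem iteratedDeriv_gaussianDensity_line {x v : E k} (hv : ‖v‖ = 1) (n : ℕ) (t : ℝ) :
    iteratedDeriv n (fun t : ℝ => gaussianDensity k (x + t • v)) t =
      (2 * Real.pi) ^ (-(k : ℝ) / 2) * ((-1) ^ n *
        (Polynomial.aeval (inner ℝ x v + t) (Polynomial.hermite n) *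
          Real.exp (-‖x + t • v‖ ^ 2 / 2))) := by
  have h1 : (fun t : ℝ => gaussianDensity k (x + t • v)) = fun t =>
      ((2 * Real.pi) ^ (-(k : ℝ) / 2) * Real.exp ((inner ℝ x v ^ 2 - ‖x‖ ^ 2) / 2)) *
        (fun s => (fun y => Real.exp (-(y ^ 2 / 2))) (inner ℝ x v + s)) t :=
    funext fun t => gaussianDensity_add_smul hv t
  rw [h1, iteratedDeriv_const_mul _ (by fun_prop),
    congrFun (iteratedDeriv_comp_const_add n (fun y => Real.exp (-(y ^ 2 / 2))) (inner ℝ x v)) t,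
    iteratedDeriv_eq_iterate, Polynomial.deriv_gaussian_eq_hermite_mul_gaussian]
  have h2 : Real.exp (-‖x + t • v‖ ^ 2 / 2) = Real.exp ((inner ℝ x v ^ 2 - ‖x‖ ^ 2) / 2) *
      Real.exp (-((inner ℝ x v + t) ^ 2 / 2)) := by
    rw [← Real.exp_add, norm_add_sq_real, real_inner_smul_right, norm_smul, hv, mul_one,
      Real.norm_eq_abs, sq_abs]
    congr 1
    ring
  rw [h2]
  ring

/-- From |y|ⁿ ≤ n! e^|y| and |y| ≤ 1 + y²/4. The rate 1/4 spends only half of the Gaussian exponent,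
leaving the rest to absorb powers of ‖x‖. -/
theorem exists_abs_aeval_le_exp (P : Polynomial ℤ) :
    ∃ C : ℝ, 0 ≤ C ∧ ∀ y : ℝ, |Polynomial.aeval y P| ≤ C * Real.exp (y ^ 2 / 4) := by
  induction P using Polynomial.induction_on' with
  | add p q hp hq =>
    obtain ⟨C, hC, h⟩ := hp
    obtain ⟨C', hC', h'⟩ := hq
    refine ⟨C + C', add_nonneg hC hC', fun y => ?_⟩
    rw [map_add, add_mul]
    exact (abs_add_le _ _).trans (add_le_add (h y) (h' y))
  | monomial n a =>
    refine ⟨|(a : ℝ)| * (n.factorial * Real.exp 1), by positivity, fun y => ?_⟩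
    have h1 := Real.pow_div_factorial_le_exp |y| (abs_nonneg y) n
    rw [div_le_iff₀ (by positivity)] at h1
    have h2 : Real.exp |y| ≤ Real.exp 1 * Real.exp (y ^ 2 / 4) := by
      rw [← Real.exp_add, Real.exp_le_exp, ← sq_abs]
      nlinarith [sq_nonneg (|y| - 2)]
    rw [Polynomial.aeval_monomial, abs_mul, abs_pow, mul_assoc]
    simp only [algebraMap_int_eq, eq_intCast]
    refine mul_le_mul_of_nonneg_left ?_ (abs_nonneg _)
    calc |y| ^ n ≤ Real.exp |y| * n.factorial := h1
      _ ≤ Real.exp 1 * Real.exp (y ^ 2 / 4) * n.factorial := by gcongr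
      _ = _ := by ring

/-- The line derivatives of the Gaussian density decay faster than any power. -/
theorem exists_hermite_mul_exp_le (n : ℕ) {β : ℝ} (hβ : 0 < β) :
    ∃ C : ℝ, 0 ≤ C ∧ ∀ (x v : E k) (t : ℝ), ‖v‖ = 1 → t ∈ Icc (0 : ℝ) 1 →
      |Polynomial.aeval (inner ℝ x v + t) (Polynomial.hermite n) *
        Real.exp (-‖x + t • v‖ ^ 2 / 2)| ≤ C * (1 / (1 + ‖x‖ ^ β)) := by
  obtain ⟨C₁, hC₁, h₁⟩ := exists_abs_aeval_le_exp (Polynomial.hermite n)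
  obtain ⟨m, hm⟩ := exists_nat_ge β
  set C₂ : ℝ := 2 + m.factorial * Real.exp 2
  -- Exponent budget with a = ‖x + tv‖: the polynomial costs a²/4, and the weight costs ‖x‖²/8 ≤
  -- a²/4 + 1/4. Together they cancel −a²/2 and leave 1/4.
  refine ⟨C₁ * (C₂ * Real.exp (1 / 4)), by positivity, fun x v t hv ht => ?_⟩
  have hx := norm_nonneg x
  have hxβ : 0 ≤ ‖x‖ ^ β := Real.rpow_nonneg hx β
  have hpow : 1 + ‖x‖ ^ β ≤ C₂ * Real.exp (‖x‖ ^ 2 / 8) := by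
    have h1 : ‖x‖ ^ β ≤ 1 + ‖x‖ ^ m := by
      rcases le_total ‖x‖ 1 with h | h
      · exact (Real.rpow_le_one hx h hβ.le).trans (by linarith [pow_nonneg hx m])
      · have := Real.rpow_le_rpow_of_exponent_le h hm
        rw [Real.rpow_natCast] at this
        linarith
    have h2 := Real.pow_div_factorial_le_exp ‖x‖ hx m
    rw [div_le_iff₀ (by positivity)] at h2
    have h3 : Real.exp ‖x‖ ≤ Real.exp 2 * Real.exp (‖x‖ ^ 2 / 8) := by
      rw [← Real.exp_add, Real.exp_le_exp]
      nlinarith [sq_nonneg (‖x‖ - 4)]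
    have h4 : 1 ≤ Real.exp (‖x‖ ^ 2 / 8) := Real.one_le_exp (by positivity)
    calc 1 + ‖x‖ ^ β ≤ 2 * 1 + ‖x‖ ^ m := by linarith
      _ ≤ 2 * Real.exp (‖x‖ ^ 2 / 8) +
          Real.exp 2 * Real.exp (‖x‖ ^ 2 / 8) * m.factorial := by
        gcongr
        exact h2.trans (by gcongr)
      _ = _ := by ring
  have hin : (inner ℝ x v + t) ^ 2 ≤ ‖x + t • v‖ ^ 2 := by
    have h := abs_real_inner_le_norm (x + t • v) v
    rw [inner_add_left, real_inner_smul_left, real_inner_self_eq_norm_sq, hv, one_pow, mul_one,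
      mul_one] at h
    rw [← sq_abs]
    exact pow_le_pow_left₀ (abs_nonneg _) h 2
  have hxt : ‖x‖ ^ 2 ≤ 2 * ‖x + t • v‖ ^ 2 + 2 := by
    have h := norm_sub_le (x + t • v) (t • v)
    rw [add_sub_cancel_right, norm_smul, hv, mul_one, Real.norm_of_nonneg ht.1] at h
    have h' := pow_le_pow_left₀ hx (h.trans (add_le_add_right ht.2 _)) 2
    nlinarith [sq_nonneg (‖x + t • v‖ - 1)]
  rw [abs_mul, abs_of_pos (Real.exp_pos _), mul_one_div, le_div_iff₀ (by positivity)]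
  calc |Polynomial.aeval (inner ℝ x v + t) (Polynomial.hermite n)| *
        Real.exp (-‖x + t • v‖ ^ 2 / 2) * (1 + ‖x‖ ^ β)
      ≤ C₁ * Real.exp ((inner ℝ x v + t) ^ 2 / 4) *
        Real.exp (-‖x + t • v‖ ^ 2 / 2) * (C₂ * Real.exp (‖x‖ ^ 2 / 8)) := by
        gcongr
        exact h₁ _
    _ = C₁ * C₂ * Real.exp ((inner ℝ x v + t) ^ 2 / 4 + -‖x + t • v‖ ^ 2 / 2 + ‖x‖ ^ 2 / 8) := by
        rw [Real.exp_add, Real.exp_add]; ring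
    _ ≤ C₁ * C₂ * Real.exp (1 / 4) := by
        gcongr
        linarith
    _ = _ := by ring

theorem exists_iteratedDeriv_gaussianDensity_le (k n : ℕ) {β : ℝ} (hβ : 0 < β) :
    ∃ C : ℝ, 0 ≤ C ∧ ∀ (x v : E k) (t : ℝ), ‖v‖ = 1 → t ∈ Icc (0 : ℝ) 1 →
      |iteratedDeriv n (fun t : ℝ => gaussianDensity k (x + t • v)) t| ≤
        C * (1 / (1 + ‖x‖ ^ β)) := by
  obtain ⟨C, hC, h⟩ := exists_hermite_mul_exp_le (k := k) n hβ
  have hc : 0 ≤ (2 * Real.pi) ^ (-(k : ℝ) / 2) := by positivity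
  refine ⟨(2 * Real.pi) ^ (-(k : ℝ) / 2) * C, mul_nonneg hc hC, fun x v t hv ht => ?_⟩
  rw [iteratedDeriv_gaussianDensity_line hv, abs_mul, abs_of_nonneg hc, abs_mul, abs_pow, abs_neg,
    abs_one, one_pow, one_mul, mul_assoc]
  exact mul_le_mul_of_nonneg_left (h x v t hv ht) hc

theorem continuous_gaussianDensity (k : ℕ) : Continuous (gaussianDensity k) := by
  unfold gaussianDensity; fun_prop

theorem gaussianDensity_nonneg (k : ℕ) (x : E k) : 0 ≤ gaussianDensity k x := by
  unfold gaussianDensity; positivity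

theorem integrable_gaussianDensity (k : ℕ) : Integrable (gaussianDensity k) := by
  have h := (GaussianFourier.integrable_cexp_neg_mul_sq_norm_add (V := E k) (b := 1 / 2)
    (by norm_num) 0 0).norm
  refine Integrable.const_mul (h.congr (Eventually.of_forall fun x => ?_)) _
  simp only [Complex.norm_exp]
  congr 1
  have : (-(1 / 2 : ℂ) * (‖x‖ : ℂ) ^ 2 + 0 * ((inner ℝ (0 : E k) x : ℝ) : ℂ)) =
      ((-‖x‖ ^ 2 / 2 : ℝ) : ℂ) := by push_cast; ring
  rw [this, Complex.ofReal_re]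

instance isFiniteMeasure_gaussianMeasure (k : ℕ) : IsFiniteMeasure (gaussianMeasure k) :=
  isFiniteMeasure_withDensity_ofReal (integrable_gaussianDensity k).2

end Gaussian

/-! ### Curvature integrals and the Hermite form of the functionals. -/

section CurvatureIntegral

variable {k : ℕ} {D : Set (E k)} {j : ℕ} {g g' : E k → ℝ}

theorem curvatureIntegrable_iff :
    CurvatureIntegrable D j g ↔ Integrable (fun p => g p * curvatureDensity D j p) (surfaceMeasure D) :=
  Iff.rfl

theorem curvatureIntegral_eq :
    curvatureIntegral D j g = ∫ p, g p * curvatureDensity D j p ∂(surfaceMeasure D) :=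
  rfl

theorem ae_surfaceMeasure {P : E k → Prop} (h : ∀ p ∈ frontier D, P p) :
    ∀ᵐ p ∂(surfaceMeasure D), P p :=
  ae_restrict_of_forall_mem isClosed_frontier.measurableSet h

theorem curvatureIntegral_congr (h : ∀ p ∈ frontier D, g p = g' p) :
    curvatureIntegral D j g = curvatureIntegral D j g' :=
  integral_congr_ae (ae_surfaceMeasure fun p hp => by simp only [h p hp])

theorem CurvatureIntegrable.congr (hg : CurvatureIntegrable D j g)
    (h : ∀ p ∈ frontier D, g p = g' p) : CurvatureIntegrable D j g' :=
  Integrable.congr (curvatureIntegrable_iff.mp hg)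
    (ae_surfaceMeasure fun p hp => by simp only [h p hp])

theorem curvatureIntegral_const_mul (c : ℝ) :
    curvatureIntegral D j (fun p => c * g p) = c * curvatureIntegral D j g := by
  simp only [curvatureIntegral_eq, mul_assoc, integral_const_mul]

theorem CurvatureIntegrable.const_mul (hg : CurvatureIntegrable D j g) (c : ℝ) :
    CurvatureIntegrable D j fun p => c * g p := by
  simp only [curvatureIntegrable_iff, mul_assoc]
  exact Integrable.const_mul hg c

theorem curvatureIntegral_sub (hg : CurvatureIntegrable D j g) (hg' : CurvatureIntegrable D j g') :
    curvatureIntegral D j (fun p => g p - g' p) =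
      curvatureIntegral D j g - curvatureIntegral D j g' := by
  simp only [curvatureIntegral_eq, sub_mul]
  exact integral_sub hg hg'

theorem CurvatureIntegrable.sum {ι : Type*} {s : Finset ι} {F : ι → E k → ℝ}
    (h : ∀ i ∈ s, CurvatureIntegrable D j (F i)) :
    CurvatureIntegrable D j fun p => ∑ i ∈ s, F i p := by
  simp only [curvatureIntegrable_iff, Finset.sum_mul]
  exact integrable_finsetSum s h

theorem curvatureIntegral_sum {ι : Type*} {s : Finset ι} {F : ι → E k → ℝ}
    (h : ∀ i ∈ s, CurvatureIntegrable D j (F i)) :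
    curvatureIntegral D j (fun p => ∑ i ∈ s, F i p) = ∑ i ∈ s, curvatureIntegral D j (F i) := by
  simp only [curvatureIntegral_eq, Finset.sum_mul]
  exact integral_finsetSum s h

/-- A function on `∂D` dominated by an integrable weight is integrable. -/
theorem CurvatureIntegrable.of_abs_le {C β : ℝ}
    (hw : CurvatureIntegrable D j fun p => 1 / (1 + ‖p‖ ^ β))
    (hg : AEStronglyMeasurable g (surfaceMeasure D))
    (hC : ∀ p ∈ frontier D, |g p| ≤ C * (1 / (1 + ‖p‖ ^ β))) :
    CurvatureIntegrable D j g ∧ |curvatureIntegral D j g| ≤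
      C * ∫ p, |1 / (1 + ‖p‖ ^ β) * curvatureDensity D j p| ∂(surfaceMeasure D) := by
  have hpos : ∀ p : E k, 0 < 1 + ‖p‖ ^ β := fun p => by positivity
  -- Measurability of the curvature density is read off from the integrable weighted density by
  -- dividing out the positive weight.
  have hdens : AEStronglyMeasurable (curvatureDensity D j) (surfaceMeasure D) := by
    have h1 : AEStronglyMeasurable (fun p : E k => 1 + ‖p‖ ^ β) (surfaceMeasure D) :=
      (measurable_const.add (measurable_norm.pow_const β)).aestronglyMeasurable
    refine (h1.mul (curvatureIntegrable_iff.mp hw).aestronglyMeasurable).congr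
      (Eventually.of_forall fun p => ?_)
    have := (hpos p).ne'
    simp only [Pi.mul_apply]
    field_simp
  have hbound : ∀ᵐ p ∂(surfaceMeasure D), ‖g p * curvatureDensity D j p‖ ≤
      C * |1 / (1 + ‖p‖ ^ β) * curvatureDensity D j p| := ae_surfaceMeasure fun p hp => by
    rw [Real.norm_eq_abs, abs_mul, abs_mul, abs_of_pos (one_div_pos.mpr (hpos p)), ← mul_assoc]
    exact mul_le_mul_of_nonneg_right (hC p hp) (abs_nonneg _)
  have hint := (curvatureIntegrable_iff.mp hw).abs.const_mul C
  refine ⟨hint.mono' (hg.mul hdens) hbound, ?_⟩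
  rw [← integral_const_mul]
  exact norm_integral_le_of_norm_le hint hbound

theorem curvatureDensity_succ (p : E k) :
    curvatureDensity D (j + 1) p = (j.factorial : ℝ) * (principalCurvatures D p).esymm j := rfl

namespace IsC2Domain

theorem esymm_principalCurvatures_eq_zero (hD : IsC2Domain D) {p : E k} (hp : p ∈ frontier D)
    (hj : k ≤ j) : (principalCurvatures D p).esymm j = 0 := by
  have := hD.card_principalCurvatures hp
  rw [Multiset.esymm, Multiset.powersetCard_eq_empty _ (by omega)]
  simp

theorem curvatureDensity_eq_zero (hD : IsC2Domain D) {p : E k} (hp : p ∈ frontier D)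
    (hj : k < j) : curvatureDensity D j p = 0 := by
  rw [curvatureDensity, hD.esymm_principalCurvatures_eq_zero hp (by omega), mul_zero]

theorem curvatureIntegrable_of_lt (hD : IsC2Domain D) (hj : k < j) (g : E k → ℝ) :
    CurvatureIntegrable D j g :=
  (integrable_zero _ ℝ _).congr (ae_surfaceMeasure fun p hp => by
    show (0 : ℝ) = g p * curvatureDensity D j p
    rw [hD.curvatureDensity_eq_zero hp hj, mul_zero])

theorem aestronglyMeasurable_hermiteWeight (hD : IsC2Domain D) (m : ℕ) :
    AEStronglyMeasurable (hermiteWeight D m) (surfaceMeasure D) := by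
  have h : ContinuousOn (hermiteWeight D m) (frontier D) := by
    unfold hermiteWeight
    refine ContinuousOn.mul ?_ (by fun_prop)
    exact (Polynomial.continuous_aeval _).comp_continuousOn
      (continuousOn_id.inner hD.continuousOn_outwardNormal)
  exact h.aestronglyMeasurable isClosed_frontier.measurableSet

theorem curvatureIntegrable_hermiteWeight (hD : IsC2Domain D) {β : ℝ} (hβ : 0 < β)
    (hw : CurvatureIntegrable D j fun p => 1 / (1 + ‖p‖ ^ β)) (m : ℕ) :
    CurvatureIntegrable D j (hermiteWeight D m) := by
  obtain ⟨C, -, h⟩ := exists_hermite_mul_exp_le (k := k) m hβ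
  refine (hw.of_abs_le (C := C) (hD.aestronglyMeasurable_hermiteWeight m) fun p hp => ?_).1
  simpa [hermiteWeight] using
    h p (outwardNormal D p) 0 (hD.norm_outwardNormal hp) ⟨le_rfl, zero_le_one⟩

/-- The normal derivative `d^i φ / dν^i` of the Gaussian density. -/
noncomputable def _root_.GaussTube.gaussianNormalDeriv (D : Set (E k)) (i : ℕ) (p : E k) : ℝ :=
  iteratedDeriv i (fun t : ℝ => gaussianDensity k (p + t • outwardNormal D p)) 0

theorem gaussianNormalDeriv_eq (hD : IsC2Domain D) {p : E k} (hp : p ∈ frontier D) (i : ℕ) :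
    gaussianNormalDeriv D i p =
      (2 * Real.pi) ^ (-(k : ℝ) / 2) * (-1) ^ i * hermiteWeight D i p := by
  rw [gaussianNormalDeriv, iteratedDeriv_gaussianDensity_line (hD.norm_outwardNormal hp),
    hermiteWeight, add_zero, zero_smul, add_zero, mul_assoc]

theorem curvatureIntegral_gaussianNormalDeriv (hD : IsC2Domain D) (i : ℕ) :
    curvatureIntegral D j (gaussianNormalDeriv D i) =
      (2 * Real.pi) ^ (-(k : ℝ) / 2) * (-1) ^ i * curvatureIntegral D j (hermiteWeight D i) := by
  rw [curvatureIntegral_congr fun p hp => hD.gaussianNormalDeriv_eq hp i,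
    curvatureIntegral_const_mul]

theorem curvatureIntegrable_gaussianNormalDeriv (hD : IsC2Domain D) {β : ℝ} (hβ : 0 < β)
    (hw : CurvatureIntegrable D j fun p => 1 / (1 + ‖p‖ ^ β)) (i : ℕ) :
    CurvatureIntegrable D j (gaussianNormalDeriv D i) :=
  ((hD.curvatureIntegrable_hermiteWeight hβ hw i).const_mul
    ((2 * Real.pi) ^ (-(k : ℝ) / 2) * (-1) ^ i)).congr
    fun _ hp => (hD.gaussianNormalDeriv_eq hp i).symm

theorem _root_.GaussTube.gaussianMinkowski_succ (D : Set (E k)) (l : ℕ) :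
    gaussianMinkowski D (l + 1) = ∑ m ∈ Finset.range (l + 1),
      (l.choose m : ℝ) * curvatureIntegral D (m + 1) (gaussianNormalDeriv D (l - m)) := by
  rw [gaussianMinkowski, tubeCoeff]
  refine Finset.sum_congr rfl fun m _ => ?_
  rw [← curvatureIntegral_const_mul]
  rfl

/-- The substitution m ↦ l − 1 − m and the symmetry of binomials match the sums term by term.
Constants leave each integral even if it diverges, since it then has the default value 0. -/
theorem gaussianMinkowski_eq_sum_hermite (hD : IsC2Domain D) {l : ℕ} (hl : 1 ≤ l) :
    gaussianMinkowski D l = (2 * Real.pi) ^ (-(k : ℝ) / 2) * ∑ m ∈ Finset.range l,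
      (-1 : ℝ) ^ m * ((l - 1).choose m : ℝ) * curvatureIntegral D (l - m) (hermiteWeight D m) := by
  obtain ⟨l, rfl⟩ := Nat.exists_eq_add_of_le' hl
  rw [gaussianMinkowski_succ, ← Finset.sum_range_reflect, Finset.mul_sum]
  refine Finset.sum_congr rfl fun m hm => ?_
  have hm' : m ≤ l := Nat.lt_succ_iff.mp (Finset.mem_range.mp hm)
  rw [add_tsub_cancel_right, Nat.choose_symm hm', Nat.sub_sub_self hm',
    hD.curvatureIntegral_gaussianNormalDeriv, Nat.sub_add_comm hm']
  ring

end IsC2Domain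

end CurvatureIntegral

/-! ### Weyl's formula and the expansion in powers of r. -/

section TubeExpansion

variable {k : ℕ} {D : Set (E k)} {R r : ℝ}

/-- The moment `∫₀ʳ tʲ φ(p + t ν_p) dt`. -/
noncomputable def normalMoment (D : Set (E k)) (j : ℕ) (r : ℝ) (p : E k) : ℝ :=
  ∫ t in (0 : ℝ)..r, t ^ j * gaussianDensity k (p + t • outwardNormal D p)

namespace IsC2Domain

theorem surfaceMeasure_prod_restrict (hD : IsC2Domain D) (r : ℝ) :
    ((surfaceMeasure D).prod volume).restrict (frontier D ×ˢ Ioc 0 r) =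
      (surfaceMeasure D).prod (volume.restrict (Ioc 0 r)) := by
  have := hD.isLocallyFiniteMeasure_surfaceMeasure
  rw [← Measure.prod_restrict]
  congr 1
  rw [surfaceMeasure, Measure.restrict_restrict isClosed_frontier.measurableSet, inter_self]

theorem aestronglyMeasurable_of_continuousOn (hD : IsC2Domain D) {F : E k × ℝ → ℝ}
    (hF : ContinuousOn F (frontier D ×ˢ univ)) (r : ℝ) :
    AEStronglyMeasurable F ((surfaceMeasure D).prod (volume.restrict (Ioc 0 r))) := by
  rw [← hD.surfaceMeasure_prod_restrict]
  exact (hF.mono (prod_mono_right (subset_univ _))).aestronglyMeasurable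
    (isClosed_frontier.measurableSet.prod measurableSet_Ioc)

theorem continuousOn_gaussianDensity_normalMap (hD : IsC2Domain D) :
    ContinuousOn (fun z => gaussianDensity k (normalMap D z)) (frontier D ×ˢ univ) :=
  (continuous_gaussianDensity k).comp_continuousOn hD.continuousOn_normalMap

theorem aestronglyMeasurable_normalMoment (hD : IsC2Domain D) (j : ℕ) (hr : 0 ≤ r) :
    AEStronglyMeasurable (normalMoment D j r) (surfaceMeasure D) := by
  have h := (hD.aestronglyMeasurable_of_continuousOn (F := fun z => z.2 ^ j *
    gaussianDensity k (normalMap D z)) ((by fun_prop : Continuous fun z : E k × ℝ =>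
      z.2 ^ j).continuousOn.mul hD.continuousOn_gaussianDensity_normalMap) r).integral_prod_right'
  refine h.congr (Eventually.of_forall fun p => ?_)
  simp only [normalMoment, intervalIntegral.integral_of_le hr, normalMap]

/-- The Gaussian volume of the tube around `D` by Weyl's formula. -/
theorem gaussianMeasure_real_tube_diff (hD : IsC2Domain D) (hU : UniqueNearest D R) (hr0 : 0 ≤ r)
    (hrR : r < R) : (gaussianMeasure k).real (tube D r \ D) =
      ∫ p, (∫ t in Ioc 0 r, normalJacobian D (p, t) * gaussianDensity k (normalMap D (p, t)))
        ∂(surfaceMeasure D) := by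
  have hR := hr0.trans_lt hrR
  have := hD.isLocallyFiniteMeasure_surfaceMeasure
  have htube : MeasurableSet (tube D r \ D) :=
    (measurableSet_le (Metric.continuous_infDist_pt D).measurable measurable_const).diff
      hD.isClosed.measurableSet
  set F : E k × ℝ → ℝ := fun z => normalJacobian D z * gaussianDensity k (normalMap D z) with hF
  have hFm : AEStronglyMeasurable F ((surfaceMeasure D).prod (volume.restrict (Ioc 0 r))) :=
    hD.aestronglyMeasurable_of_continuousOn
      (hD.continuousOn_normalJacobian.mul hD.continuousOn_gaussianDensity_normalMap) r
  have hJ : ∀ z ∈ frontier D ×ˢ Ioc 0 r, 0 ≤ normalJacobian D z := fun z hz =>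
    (hD.det_one_add_smul_normalDerivative_pos hU hz.1 hz.2.1.le (hz.2.2.trans_lt hrR)).le
  have hS : MeasurableSet (frontier D ×ˢ Ioc 0 r) :=
    isClosed_frontier.measurableSet.prod measurableSet_Ioc
  have hF0 : 0 ≤ᵐ[(surfaceMeasure D).prod (volume.restrict (Ioc 0 r))] F := by
    rw [← hD.surfaceMeasure_prod_restrict]
    exact ae_restrict_of_forall_mem hS fun z hz =>
      mul_nonneg (hJ z hz) (gaussianDensity_nonneg k _)
  have hmeas : gaussianMeasure k (tube D r \ D) =
      ∫⁻ z, ENNReal.ofReal (F z) ∂((surfaceMeasure D).prod (volume.restrict (Ioc 0 r))) := by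
    rw [gaussianMeasure, withDensity_apply _ htube, hD.lintegral_tube_diff hU hR hrR
      (continuous_gaussianDensity k).measurable.ennreal_ofReal, ← hD.surfaceMeasure_prod_restrict]
    refine setLIntegral_congr_fun hS fun z hz => ?_
    simp only [hF]
    rw [ENNReal.ofReal_mul (hJ z hz)]
  -- Nonnegativity of the integrand and finiteness of γ give integrability of the full Jacobian, so
  -- Fubini applies before it is split into curvature terms.
  have hint : Integrable F ((surfaceMeasure D).prod (volume.restrict (Ioc 0 r))) := by
    rw [← lintegral_ofReal_ne_top_iff_integrable hFm hF0, ← hmeas]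
    exact measure_ne_top _ _
  rw [measureReal_def, hmeas, ← integral_eq_lintegral_of_nonneg_ae hF0 hFm, integral_prod _ hint]

/-- The Jacobian is a polynomial in t of degree below k, so any n ≥ k may end the sum. The 1/j!
offsets the factorial in the curvature density. -/
theorem integral_normalJacobian_mul (hD : IsC2Domain D) {p : E k} (hp : p ∈ frontier D)
    (hr0 : 0 ≤ r) {n : ℕ} (hn : k ≤ n) :
    ∫ t in Ioc 0 r, normalJacobian D (p, t) * gaussianDensity k (normalMap D (p, t)) =
      ∑ j ∈ Finset.range n, (j.factorial : ℝ)⁻¹ *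
        (normalMoment D j r p * curvatureDensity D (j + 1) p) := by
  have hsum : ∀ t, normalJacobian D (p, t) =
      ∑ j ∈ Finset.range n, t ^ j * (principalCurvatures D p).esymm j := fun t => by
    rw [normalJacobian, hD.det_one_add_smul_normalDerivative_eq_sum hp]
    refine Finset.sum_subset (Finset.range_subset_range.mpr hn) fun j _ hj => ?_
    rw [hD.esymm_principalCurvatures_eq_zero hp (not_lt.mp (Finset.mem_range.not.mp hj)), mul_zero]
  have hc := (contDiff_gaussianDensity_line p (outwardNormal D p)).continuous
  rw [← intervalIntegral.integral_of_le hr0]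
  simp only [hsum, Finset.sum_mul, normalMap]
  rw [intervalIntegral.integral_finsetSum
    fun i _ => (by fun_prop : Continuous _).intervalIntegrable _ _]
  refine Finset.sum_congr rfl fun j _ => ?_
  have hj : (j.factorial : ℝ) ≠ 0 := by exact_mod_cast j.factorial_ne_zero
  rw [curvatureDensity_succ, normalMoment, mul_left_comm (_ : ℝ) (j.factorial : ℝ),
    inv_mul_cancel_left₀ hj, ← intervalIntegral.integral_mul_const]
  exact intervalIntegral.integral_congr fun t _ => by ring

/-- The Taylor remainder of the moment is at most r^(N+1) times a constant multiple of the weight,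
uniformly in p, so integrating over ∂D keeps the order in r. -/
theorem exists_curvatureIntegral_normalMoment (hD : IsC2Domain D) (N j : ℕ) {β : ℝ} (hβ : 0 < β)
    (hw : CurvatureIntegrable D (j + 1) fun p => 1 / (1 + ‖p‖ ^ β)) :
    ∃ K : ℝ, ∀ r ∈ Icc (0 : ℝ) 1, CurvatureIntegrable D (j + 1) (normalMoment D j r) ∧
      |(j.factorial : ℝ)⁻¹ * curvatureIntegral D (j + 1) (normalMoment D j r) -
        ∑ i ∈ Finset.range (N - j), r ^ (i + j + 1) / ((i + j + 1).factorial : ℝ) *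
          (((i + j).choose j : ℝ) * curvatureIntegral D (j + 1) (gaussianNormalDeriv D i))| ≤
        K * r ^ (N + 1) := by
  obtain ⟨B₀, hB₀, h₀⟩ := exists_iteratedDeriv_gaussianDensity_le k 0 hβ
  obtain ⟨B, hB, h⟩ := exists_iteratedDeriv_gaussianDensity_le k (N - j) hβ
  set W := ∫ p, |1 / (1 + ‖p‖ ^ β) * curvatureDensity D (j + 1) p| ∂(surfaceMeasure D)
  refine ⟨(j.factorial : ℝ)⁻¹ * (B * W), fun r hr => ?_⟩
  have hm := hD.aestronglyMeasurable_normalMoment j hr.1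
  have hweight : ∀ p : E k, 0 ≤ 1 / (1 + ‖p‖ ^ β) := fun p => by positivity
  have hmom : CurvatureIntegrable D (j + 1) (normalMoment D j r) := by
    refine (hw.of_abs_le (C := B₀) hm fun p hp => ?_).1
    have h1 := abs_integral_pow_mul_sub_le (contDiff_gaussianDensity_line p (outwardNormal D p)) j 0
      (fun t ht => h₀ p (outwardNormal D p) t (hD.norm_outwardNormal hp) ht) hr
    rw [Finset.range_zero, Finset.sum_empty, sub_zero] at h1
    exact h1.trans (mul_le_of_le_one_right (mul_nonneg hB₀ (hweight p)) (pow_le_one₀ hr.1 hr.2))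
  refine ⟨hmom, ?_⟩
  have hderiv := fun i => hD.curvatureIntegrable_gaussianNormalDeriv hβ hw i
  set c : ℕ → ℝ := fun i => (i.factorial : ℝ)⁻¹ * (r ^ (i + j + 1) / (i + j + 1)) with hc
  have hTi : ∀ i ∈ Finset.range (N - j),
      CurvatureIntegrable D (j + 1) fun p => c i * gaussianNormalDeriv D i p :=
    fun i _ => (hderiv i).const_mul (c i)
  have hTm : AEStronglyMeasurable (fun p => ∑ i ∈ Finset.range (N - j), c i * gaussianNormalDeriv D i p)
      (surfaceMeasure D) := by
    refine Finset.aestronglyMeasurable_fun_sum _ fun i _ => AEStronglyMeasurable.const_mul ?_ _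
    refine ((hD.aestronglyMeasurable_hermiteWeight i).const_mul
      ((2 * Real.pi) ^ (-(k : ℝ) / 2) * (-1) ^ i)).congr ?_
    exact ae_surfaceMeasure fun p hp => (hD.gaussianNormalDeriv_eq hp i).symm
  have hdiff := (hw.of_abs_le (C := B * r ^ (N + 1)) (hm.sub hTm) fun p hp => by
    have h1 := abs_integral_pow_mul_sub_le (contDiff_gaussianDensity_line p (outwardNormal D p)) j
      (N - j) (fun t ht => h p (outwardNormal D p) t (hD.norm_outwardNormal hp) ht) hr
    -- The subtraction truncates: for j > N there are no Taylor terms and the exponent j + 1 exceeds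
    -- N + 1, which is harmless as r ≤ 1.
    have h2 : r ^ (N - j + j + 1) ≤ r ^ (N + 1) := pow_le_pow_of_le_one hr.1 hr.2 (by omega)
    have h3 : ∑ i ∈ Finset.range (N - j), c i * gaussianNormalDeriv D i p =
        ∑ i ∈ Finset.range (N - j), iteratedDeriv i
          (fun t : ℝ => gaussianDensity k (p + t • outwardNormal D p)) 0 / i.factorial *
            (r ^ (i + j + 1) / (i + j + 1)) :=
      Finset.sum_congr rfl fun i _ => by rw [hc, gaussianNormalDeriv]; ring
    rw [Pi.sub_apply, h3]
    refine h1.trans ?_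
    rw [mul_right_comm B (r ^ (N + 1))]
    exact mul_le_mul_of_nonneg_left h2 (mul_nonneg hB (hweight p))).2
  have hCI : curvatureIntegral D (j + 1) (normalMoment D j r -
      fun p => ∑ i ∈ Finset.range (N - j), c i * gaussianNormalDeriv D i p) =
      curvatureIntegral D (j + 1) (normalMoment D j r) - ∑ i ∈ Finset.range (N - j),
        c i * curvatureIntegral D (j + 1) (gaussianNormalDeriv D i) := by
    rw [show (normalMoment D j r - fun p => ∑ i ∈ Finset.range (N - j), c i * gaussianNormalDeriv D i p)
      = fun p => normalMoment D j r p - ∑ i ∈ Finset.range (N - j), c i * gaussianNormalDeriv D i p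
      from rfl, curvatureIntegral_sub hmom (CurvatureIntegrable.sum hTi), curvatureIntegral_sum hTi]
    simp only [curvatureIntegral_const_mul]
  rw [hCI] at hdiff
  -- Both sides equal r^(i+j+1) / (i! j! (i + j + 1)): this is how the binomials of M_l^γ arise.
  have hcoeff : ∀ i, r ^ (i + j + 1) / ((i + j + 1).factorial : ℝ) * ((i + j).choose j : ℝ) =
      (j.factorial : ℝ)⁻¹ * c i := fun i => by
    have h1 : ((i + j).choose j : ℝ) * (i.factorial * j.factorial) = (i + j).factorial := by
      have := Nat.choose_mul_factorial_mul_factorial (Nat.le_add_left j i)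
      rw [Nat.add_sub_cancel] at this
      rw [mul_comm (i.factorial : ℝ), ← mul_assoc]
      exact_mod_cast this
    have h2 : ((i + j + 1).factorial : ℝ) = (i + j + 1) * (i + j).factorial := by
      rw [Nat.factorial_succ]; push_cast; ring
    have h3 : (i.factorial : ℝ) ≠ 0 := by exact_mod_cast i.factorial_ne_zero
    have h4 : (j.factorial : ℝ) ≠ 0 := by exact_mod_cast j.factorial_ne_zero
    have h5 : ((i + j).choose j : ℝ) ≠ 0 := by
      exact_mod_cast (Nat.choose_pos (Nat.le_add_left j i)).ne'
    have h6 : (i + j + 1 : ℝ) ≠ 0 := by positivity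
    rw [h2, ← h1, hc]
    field_simp
  have hfin : (j.factorial : ℝ)⁻¹ * curvatureIntegral D (j + 1) (normalMoment D j r) -
        ∑ i ∈ Finset.range (N - j), r ^ (i + j + 1) / ((i + j + 1).factorial : ℝ) *
          (((i + j).choose j : ℝ) * curvatureIntegral D (j + 1) (gaussianNormalDeriv D i)) =
      (j.factorial : ℝ)⁻¹ * (curvatureIntegral D (j + 1) (normalMoment D j r) -
        ∑ i ∈ Finset.range (N - j), c i * curvatureIntegral D (j + 1) (gaussianNormalDeriv D i)) := by
    rw [mul_sub, Finset.mul_sum]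
    congr 1
    exact Finset.sum_congr rfl fun i _ => by rw [← mul_assoc, hcoeff, mul_assoc]
  rw [hfin, abs_mul, abs_of_nonneg (by positivity : (0 : ℝ) ≤ (j.factorial : ℝ)⁻¹), mul_assoc]
  refine mul_le_mul_of_nonneg_left (hdiff.trans_eq ?_) (by positivity)
  ring

/-- Summation along diagonals, with power i + j + 1. Indices j ≥ N contribute empty inner sums, so
the outer range may be enlarged. -/
theorem sum_gaussianMinkowski_eq (D : Set (E k)) (r : ℝ) (N : ℕ) :
    ∑ j ∈ Finset.Icc 1 N, r ^ j / (j.factorial : ℝ) * gaussianMinkowski D j =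
      ∑ j ∈ Finset.range (k + N), ∑ i ∈ Finset.range (N - j),
        r ^ (i + j + 1) / ((i + j + 1).factorial : ℝ) *
          (((i + j).choose j : ℝ) * curvatureIntegral D (j + 1) (gaussianNormalDeriv D i)) := by
  have h1 : ∑ j ∈ Finset.Icc 1 N, r ^ j / (j.factorial : ℝ) * gaussianMinkowski D j =
      ∑ l ∈ Finset.range N, r ^ (l + 1) / ((l + 1).factorial : ℝ) * gaussianMinkowski D (l + 1) := by
    induction N with
    | zero => simp
    | succ n ih => rw [Finset.sum_Icc_succ_top (by omega), Finset.sum_range_succ, ih]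
  rw [h1]
  have h2 := Finset.sum_range_diag_flip N fun j i =>
    r ^ (i + j + 1) / ((i + j + 1).factorial : ℝ) *
      (((i + j).choose j : ℝ) * curvatureIntegral D (j + 1) (gaussianNormalDeriv D i))
  have h3 : ∑ j ∈ Finset.range N, ∑ i ∈ Finset.range (N - j),
        r ^ (i + j + 1) / ((i + j + 1).factorial : ℝ) *
          (((i + j).choose j : ℝ) * curvatureIntegral D (j + 1) (gaussianNormalDeriv D i)) =
      ∑ j ∈ Finset.range (k + N), ∑ i ∈ Finset.range (N - j),
        r ^ (i + j + 1) / ((i + j + 1).factorial : ℝ) *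
          (((i + j).choose j : ℝ) * curvatureIntegral D (j + 1) (gaussianNormalDeriv D i)) := by
    refine Finset.sum_subset (Finset.range_subset_range.mpr (by omega)) fun j _ hj => ?_
    rw [Nat.sub_eq_zero_of_le (not_lt.mp (Finset.mem_range.not.mp hj)), Finset.range_zero,
      Finset.sum_empty]
  rw [← h3, ← h2]
  refine Finset.sum_congr rfl fun l _ => ?_
  rw [gaussianMinkowski_succ, Finset.mul_sum]
  refine Finset.sum_congr rfl fun m hm => ?_
  rw [Nat.sub_add_cancel (Nat.lt_succ_iff.mp (Finset.mem_range.mp hm))]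

theorem exists_abs_gaussianMeasure_tube_sub_le (hD : IsC2Domain D)
    (hw : ∀ j : ℕ, ∃ β : ℝ, 0 < β ∧ CurvatureIntegrable D (j + 1) fun p => 1 / (1 + ‖p‖ ^ β))
    (N : ℕ) : ∃ K : ℝ, ∀ r : ℝ, 0 ≤ r → ENNReal.ofReal r < min (criticalRadius D) 1 →
      |(gaussianMeasure k).real (tube D r) - ((gaussianMeasure k).real D +
        ∑ j ∈ Finset.Icc 1 N, r ^ j / (j.factorial : ℝ) * gaussianMinkowski D j)| ≤
        K * r ^ (N + 1) := by
  choose β hβ hwβ using hw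
  choose K hK using fun j => hD.exists_curvatureIntegral_normalMoment N j (hβ j) (hwβ j)
  -- The length k + N is at least k, covering the whole Jacobian polynomial, and at least N,
  -- covering all terms of the expansion.
  refine ⟨∑ j ∈ Finset.range (k + N), K j, fun r hr0 hr => ?_⟩
  obtain ⟨hrc, hr1⟩ := lt_min_iff.mp hr
  have hr1' : r ≤ 1 := by
    rw [← ENNReal.ofReal_one] at hr1
    exact (ENNReal.ofReal_lt_ofReal_iff one_pos).mp hr1 |>.le
  obtain ⟨R, hrR, hU⟩ := exists_uniqueNearest_of_lt_criticalRadius hr0 hrc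
  have hsub : D ⊆ tube D r := fun x hx => (Metric.infDist_zero_of_mem hx).trans_le hr0
  have hdiff := measureReal_sdiff (μ := gaussianMeasure k) hsub hD.isClosed.measurableSet
  have hmain : (gaussianMeasure k).real (tube D r \ D) = ∑ j ∈ Finset.range (k + N),
      (j.factorial : ℝ)⁻¹ * curvatureIntegral D (j + 1) (normalMoment D j r) := by
    rw [hD.gaussianMeasure_real_tube_diff hU hr0 hrR]
    simp only [curvatureIntegral_eq, ← integral_const_mul]
    rw [← integral_finsetSum _ fun j _ => Integrable.const_mul
      (curvatureIntegrable_iff.mp (hK j r ⟨hr0, hr1'⟩).1) _]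
    exact integral_congr_ae (ae_surfaceMeasure fun p hp =>
      hD.integral_normalJacobian_mul hp hr0 (Nat.le_add_right k N))
  rw [← sub_sub, ← hdiff, hmain, sum_gaussianMinkowski_eq, ← Finset.sum_sub_distrib, Finset.sum_mul]
  exact (Finset.abs_sum_le_sum_abs _ _).trans
    (Finset.sum_le_sum fun j _ => (hK j r ⟨hr0, hr1'⟩).2)

end IsC2Domain

end TubeExpansion

end GaussTube

theorem corollary3p4 (k : ℕ) (D : Set (GaussTube.E k)) (hD : GaussTube.IsC2Domain D)
    (hr : 0 < GaussTube.criticalRadius D) :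
    (∀ l : ℕ, 1 ≤ l →
      GaussTube.gaussianMinkowski D l =
        (2 * Real.pi) ^ (-(k : ℝ) / 2) * ∑ m ∈ Finset.range l,
          (-1 : ℝ) ^ m * ((l - 1).choose m : ℝ) *
            GaussTube.curvatureIntegral D (l - m) (GaussTube.hermiteWeight D m)) ∧
    ((∀ j : ℕ, 1 ≤ j → j ≤ k → ∃ β : ℝ, 0 < β ∧
        GaussTube.CurvatureIntegrable D j fun p => 1 / (1 + ‖p‖ ^ β)) →
      (∀ l : ℕ, 1 ≤ l → ∀ m < l,
        GaussTube.CurvatureIntegrable D (l - m) (GaussTube.hermiteWeight D m)) ∧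
      ∀ N : ℕ, ∃ K : ℝ, ∀ r : ℝ, 0 ≤ r → ENNReal.ofReal r < min (GaussTube.criticalRadius D) 1 →
        |(GaussTube.gaussianMeasure k).real (GaussTube.tube D r) -
            ((GaussTube.gaussianMeasure k).real D +
              ∑ j ∈ Finset.Icc 1 N, r ^ j / (j.factorial : ℝ) * GaussTube.gaussianMinkowski D j)|
          ≤ K * r ^ (N + 1)) := by
  refine ⟨fun l hl => hD.gaussianMinkowski_eq_sum_hermite hl, fun hw => ?_⟩
  -- Beyond order k the curvature density vanishes on ∂D, so any exponent will do there.
  have hw' : ∀ j : ℕ, ∃ β : ℝ, 0 < β ∧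
      GaussTube.CurvatureIntegrable D (j + 1) fun p => 1 / (1 + ‖p‖ ^ β) := fun j => by
    rcases le_or_gt (j + 1) k with h | h
    · exact hw (j + 1) (Nat.le_add_left 1 j) h
    · exact ⟨1, one_pos, hD.curvatureIntegrable_of_lt h _⟩
  refine ⟨fun l _ m hm => ?_, hD.exists_abs_gaussianMeasure_tube_sub_le hw'⟩
  obtain ⟨β, hβ, h⟩ := hw' (l - m - 1)
  rw [Nat.sub_add_cancel (Nat.sub_pos_of_lt hm)] at h
  exact hD.curvatureIntegrable_hermiteWeight hβ h m
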